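/- Let $\Omega$ be $[0,1]$ or the real line $\mathbb{R}$, with Lebesgue measure $\mu$ (functions equal $\mu$-a.e. are identified). Let $E$ be a complex symmetric (rearrangement-invariant) Banach function space on $\Omega$, i.e. a Banach space of measurable functions $f:\Omega\to\mathbb{C}$ such that * (ideal) if $f\in E$, $g$ is measurable and $|g|\le|f|$ a.e., then $g\in E$ and $\|g\|_E\le\|f\|_E$; * (symmetric) if $f\in E$, $g$ is measurable and $\mu\{|g|>s\}=\mu\{|f|>s\}$ for all $s$, then $g\in E$ and $\|g\|_E=\|f\|_E$; * $\chi_\sigma\in E$ for every measurable $\sigma\subseteq\Omega$ with $\mu(\sigma)<\infty$. Suppose that the norm of $E$ is not proportional to the norm of $L_2(\Omega,\mu)$, i.e. there is no constant $k>0$ with $\|f\|_E=k\|f\|_{L_2(\mu)}$ for all $f\in E$. Call a bounded linear operator $H$ on $E$ Hermitian if $\|e^{itH}\|=1$ for all $t\in\mathbb{R}$, and let $\mathrm{Herm}(E)$ be the set of Hermitian operators on $E$. Then $\mathrm{Herm}(E)$ is exactly the set of the multiplication operators $f\mapsto hf$ with $h:\Omega\to\mathbb{R}$ bounded and measurable.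 -/

import Mathlib

open MeasureTheory

noncomputable section

/-- A complex Banach ideal space over `μ`: a linear space of classes of `μ`-measurable complex
functions (modulo equality `μ`-almost everywhere) with a complete norm, such that `f ∈ E`,
`g ∈ L⁰(μ)` and `|g| ≤ |f|` imply `g ∈ E` and `‖g‖ ≤ ‖f‖`, and which contains the characteristic
function of every measurable set of finite measure. -/
structure BanachIdealSpace {α : Type*} [MeasurableSpace α] (μ : Measure α) where
  /-- the elements of the space -/
  carrier : Submodule ℂ (α →ₘ[μ] ℂ)
  /-- the norm of the space -/
  nrm : Seminorm ℂ carrier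
  eq_zero_of_nrm_eq_zero : ∀ f : carrier, nrm f = 0 → f = 0
  complete : ∀ u : ℕ → carrier,
    (∀ ε : ℝ, 0 < ε → ∃ N : ℕ, ∀ m ≥ N, ∀ n ≥ N, nrm (u m - u n) < ε) →
      ∃ f : carrier, Filter.Tendsto (fun n => nrm (u n - f)) Filter.atTop (nhds 0)
  ideal : ∀ (f : carrier) (g : α →ₘ[μ] ℂ), (∀ᵐ x ∂μ, ‖g x‖ ≤ ‖(f : α →ₘ[μ] ℂ) x‖) →
    ∃ hg : g ∈ carrier, nrm ⟨g, hg⟩ ≤ nrm f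
  indicator_mem : ∀ (s : Set α) (hs : MeasurableSet s), μ s < ⊤ →
    AEEqFun.mk (s.indicator fun _ => (1 : ℂ))
      ((aestronglyMeasurable_const (μ := μ)).indicator hs) ∈ carrier

namespace BanachIdealSpace

variable {α : Type*} [MeasurableSpace α] {μ : Measure α}

instance : CoeSort (BanachIdealSpace μ) (Type _) := ⟨fun E => E.carrier⟩

/-- The underlying class of measurable functions of an element of `E`. -/
def toL0 {E : BanachIdealSpace μ} (f : E) : α →ₘ[μ] ℂ := f.1

instance instNormedAddCommGroup (E : BanachIdealSpace μ) : NormedAddCommGroup E :=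
  AddGroupNorm.toNormedAddCommGroup
    { toFun := E.nrm
      map_zero' := map_zero E.nrm
      add_le' := map_add_le_add E.nrm
      neg' := map_neg_eq_map E.nrm
      eq_zero_of_map_eq_zero' := E.eq_zero_of_nrm_eq_zero }

theorem norm_def (E : BanachIdealSpace μ) (f : E) : ‖f‖ = E.nrm f := rfl

instance instNormedSpace (E : BanachIdealSpace μ) : NormedSpace ℂ E where
  norm_smul_le c f := (map_smul_eq_mul E.nrm c f).le

instance instCompleteSpace (E : BanachIdealSpace μ) : CompleteSpace E := by
  refine Metric.complete_of_cauchySeq_tendsto fun u hu => ?_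
  rw [Metric.cauchySeq_iff] at hu
  obtain ⟨f, hf⟩ := E.complete u fun ε hε => by
    obtain ⟨N, hN⟩ := hu ε hε
    refine ⟨N, fun m hm n hn => ?_⟩
    rw [← norm_def, ← dist_eq_norm]
    exact hN m hm n hn
  exact ⟨f, tendsto_iff_norm_sub_tendsto_zero.2 hf⟩

/-- The moduli of `f` and `g` are equimeasurable: they have the same distribution function. -/
def Equimeasurable (f g : α →ₘ[μ] ℂ) : Prop :=
  ∀ s : ℝ, μ {x | s < ‖f x‖} = μ {x | s < ‖g x‖}

/-- `E` is symmetric (rearrangement-invariant): if `f ∈ E`, `g ∈ L⁰(μ)` and `|f|`, `|g|` are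
equimeasurable, then `g ∈ E` and `‖g‖ = ‖f‖`. -/
def IsSymmetric (E : BanachIdealSpace μ) : Prop :=
  ∀ (f : E) (g : α →ₘ[μ] ℂ), Equimeasurable (toL0 f) g →
    ∃ hg : g ∈ E.carrier, ‖(⟨g, hg⟩ : E)‖ = ‖f‖

/-- The norm of `E` is a constant multiple of the norm of `L₂(μ)`. -/
def NormProportionalToL2 (E : BanachIdealSpace μ) : Prop :=
  ∃ k : ℝ, 0 < k ∧ ∀ f : E, ENNReal.ofReal ‖f‖ = ENNReal.ofReal k * eLpNorm (toL0 f) 2 μ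

/-- The class in `L⁰(μ)` of a measurable real function, seen as a complex function. -/
def ofRealFun (μ : Measure α) (h : α → ℝ) (hm : Measurable h) : α →ₘ[μ] ℂ :=
  AEEqFun.mk (fun x => (h x : ℂ)) (Complex.measurable_ofReal.comp hm).aestronglyMeasurable

theorem mul_mem (E : BanachIdealSpace μ) (h : α → ℝ) (hm : Measurable h) (C : ℝ)
    (hC : ∀ x, |h x| ≤ C) (f : E) :
    ∃ hg : ofRealFun μ h hm * toL0 f ∈ E.carrier,
      ‖(⟨ofRealFun μ h hm * toL0 f, hg⟩ : E)‖ ≤ |C| * ‖f‖ := by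
  have key : ∀ᵐ x ∂μ, ‖(ofRealFun μ h hm * toL0 f) x‖ ≤ ‖(((C : ℂ) • f : E) : α →ₘ[μ] ℂ) x‖ := by
    have e1 : ⇑(ofRealFun μ h hm) =ᵐ[μ] fun x => (h x : ℂ) := AEEqFun.coeFn_mk _ _
    have e2 := AEEqFun.coeFn_mul (ofRealFun μ h hm) (toL0 f)
    have e3 : ⇑((((C : ℂ) • f : E) : α →ₘ[μ] ℂ)) =ᵐ[μ] (C : ℂ) • ⇑(toL0 f) :=
      AEEqFun.coeFn_smul (C : ℂ) (toL0 f)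
    filter_upwards [e1, e2, e3] with x h1 h2 h3
    rw [h2, h3, Pi.mul_apply, h1, Pi.smul_apply, norm_mul, norm_smul, Complex.norm_real,
      Complex.norm_real]
    exact mul_le_mul_of_nonneg_right ((hC x).trans (le_abs_self C)) (norm_nonneg _)
  obtain ⟨hg, hle⟩ := E.ideal ((C : ℂ) • f) _ key
  refine ⟨hg, hle.trans ?_⟩
  rw [map_smul_eq_mul, Complex.norm_real, norm_def, Real.norm_eq_abs]

theorem ofRealFun_mul_add (h : α → ℝ) (hm : Measurable h) (f g : α →ₘ[μ] ℂ) :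
    ofRealFun μ h hm * (f + g) = ofRealFun μ h hm * f + ofRealFun μ h hm * g := by
  induction f using AEEqFun.induction_on
  induction g using AEEqFun.induction_on
  simp only [ofRealFun, AEEqFun.mk_add_mk, AEEqFun.mk_mul_mk, mul_add]

theorem ofRealFun_mul_smul (h : α → ℝ) (hm : Measurable h) (c : ℂ) (f : α →ₘ[μ] ℂ) :
    ofRealFun μ h hm * (c • f) = c • (ofRealFun μ h hm * f) := by
  induction f using AEEqFun.induction_on
  rename_i u hu
  have e : c • AEEqFun.mk u hu = AEEqFun.mk (c • u) (hu.const_smul c) := rfl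
  have e2 : ∀ (v : α → ℂ) (hv : AEStronglyMeasurable v μ),
      c • AEEqFun.mk v hv = AEEqFun.mk (c • v) (hv.const_smul c) := fun _ _ => rfl
  rw [ofRealFun, e, AEEqFun.mk_mul_mk, AEEqFun.mk_mul_mk, e2]
  simp only [mul_smul_comm]

/-- The operator `f ↦ h f` of multiplication by a bounded measurable real function `h`. -/
def mulOp (E : BanachIdealSpace μ) (h : α → ℝ) (hm : Measurable h) (C : ℝ)
    (hC : ∀ x, |h x| ≤ C) : E →L[ℂ] E :=
  LinearMap.mkContinuous
    { toFun := fun f => ⟨ofRealFun μ h hm * toL0 f, (mul_mem E h hm C hC f).1⟩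
      map_add' := fun f g => Subtype.ext (ofRealFun_mul_add h hm f.1 g.1)
      map_smul' := fun c f => Subtype.ext (ofRealFun_mul_smul h hm c f.1) }
    |C| fun f => (mul_mem E h hm C hC f).2

/-- The set of all operators on `E` of multiplication by bounded real functions. -/
def realMultipliers (E : BanachIdealSpace μ) : Set (E →L[ℂ] E) :=
  {T | ∃ (h : α → ℝ) (hm : Measurable h) (C : ℝ) (hC : ∀ x, |h x| ≤ C), T = mulOp E h hm C hC}

end BanachIdealSpace

/-- The set of Hermitian operators on a complex normed space `X`: the bounded linear operators `H`
with `‖exp (i t H)‖ = 1` for all real `t`. -/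
def Herm (X : Type*) [NormedAddCommGroup X] [NormedSpace ℂ X] : Set (X →L[ℂ] X) :=
  {H | ∀ t : ℝ, ‖NormedSpace.exp ((Complex.I * (t : ℂ)) • H)‖ = 1}

end

open scoped ENNReal NNReal

noncomputable section

/-! On a nontrivial space, `H` is Hermitian exactly when `‖f + itHf‖ ≤ (1 + Ct²)‖f‖` for all real
`t`. This class is closed under sums, real multiples and conjugation by isometric involutions.
Conjugating by multiplication with ±1-valued functions isolates, for disjoint `A` and `B`, the part
`P_A H P_B + P_B H P_A` (`isHerm_cross`). A symmetric norm does not increase when a function is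
averaged over a set (`norm_le_of_eq_average`). Hence for `μ A = μ B` this part compresses to a 2×2
matrix with zero diagonal on the plane of `χ_A` and `χ_B`, Hermitian in the presence of any fixed
`w` living elsewhere (`pairHerm_of_isHerm`).

Suppose the entry from `A` to `B` is nonzero. Phases, exchange of coordinates and complex
conjugation turn the matrix into the generator of real rotations (`PairHerm.rotation`), so the norm
is rotation invariant on that plane. The same happens for sets of measure `μ A / k`, for every `k`.
Merging two coefficients at a time then shows that the norm of step functions is a multiple of their
`L₂` norm, and completeness extends this to all of `E` (`norm_le_of_forall_approx`). This is the
excluded case.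

So all entries between disjoint sets of equal measure vanish, and `H` preserves the supports of
characteristic functions. On these it acts as multiplication by a function `u`, bounded by `‖H‖`,
and real because `|1 + itu| ≤ 1 + Ct²`. Characteristic functions need not span a dense subspace, so
the difference `K` of `H` and the multiplier is treated separately: a cross part of `K` sends some
vector to `p` and `p` to `0`, which for a Hermitian operator forces `p = 0`
(`eq_zero_of_isHerm_of_ind`).

The recurring tool is `le_of_forall_le_one_add_sq_mul`: a quantity that grows by a factor at most `1
+ Ct²` over each short step `t` is constant. -/

/-! ### Divisible measures and partitions into sets of equal measure -/

/-- A measure is divisible if every measurable set contains measurable subsets of every smaller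
measure. -/
def DivisibleMeasure {α : Type*} [MeasurableSpace α] (μ : Measure α) : Prop :=
  ∀ S, MeasurableSet S → ∀ r ≤ μ S, ∃ T ⊆ S, MeasurableSet T ∧ μ T = r

/-- Since `μ ≤ volume`, the measure of `S ∩ [-x, x]` is 2-Lipschitz in `x`, and the intermediate
value theorem applies. Working below `r < μ S` keeps everything finite when `μ S = ∞`. -/
theorem DivisibleMeasure.of_le_volume {μ : Measure ℝ} (hμ : μ ≤ volume) : DivisibleMeasure μ := by
  intro S hS r hr
  rcases hr.eq_or_lt with rfl | hlt
  · exact ⟨S, subset_rfl, hS, rfl⟩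
  have hun : S = ⋃ n : ℕ, S ∩ Set.Icc (-(n : ℝ)) n := by
    rw [← Set.inter_iUnion]
    refine (Set.inter_eq_left.2 fun x _ => ?_).symm
    obtain ⟨n, hn⟩ := exists_nat_ge |x|
    exact Set.mem_iUnion.2 ⟨n, abs_le.1 hn⟩
  have hmono : Monotone fun n : ℕ => S ∩ Set.Icc (-(n : ℝ)) n := by
    intro a b hab
    have : (a : ℝ) ≤ b := by exact_mod_cast hab
    exact Set.inter_subset_inter_right _ (Set.Icc_subset_Icc (by linarith) this)
  obtain ⟨n, hn⟩ : ∃ n : ℕ, r < μ (S ∩ Set.Icc (-(n : ℝ)) n) := by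
    rw [hun, hmono.measure_iUnion] at hlt
    exact lt_iSup_iff.1 hlt
  have hfin : ∀ x : ℝ, μ (S ∩ Set.Icc (-x) x) ≠ ∞ := fun x =>
    ((measure_mono Set.inter_subset_right).trans_lt ((hμ _).trans_lt (by simp))).ne
  set g : ℝ → ℝ := fun x => (μ (S ∩ Set.Icc (-x) x)).toReal with hg
  have hLip : LipschitzWith 2 g := by
    refine LipschitzWith.of_le_add_mul 2 fun x y => ?_
    have hsub : S ∩ Set.Icc (-x) x ⊆
        (S ∩ Set.Icc (-y) y) ∪ (Set.Icc y x ∪ Set.Icc (-x) (-y)) := by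
      rintro z ⟨hz, h1, h2⟩
      by_cases h3 : y ≤ z
      · exact Or.inr (Or.inl ⟨h3, h2⟩)
      · by_cases h4 : z ≤ -y
        · exact Or.inr (Or.inr ⟨h1, h4⟩)
        · exact Or.inl ⟨hz, by linarith, by linarith⟩
    have hle : μ (S ∩ Set.Icc (-x) x) ≤ μ (S ∩ Set.Icc (-y) y) +
        (ENNReal.ofReal (dist x y) + ENNReal.ofReal (dist x y)) := by
      refine (measure_mono hsub).trans ((measure_union_le _ _).trans ?_)
      gcongr
      refine (measure_union_le _ _).trans ?_
      gcongr
      · refine (hμ _).trans ?_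
        rw [Real.volume_Icc, Real.dist_eq]
        exact ENNReal.ofReal_le_ofReal (le_abs_self _)
      · refine (hμ _).trans ?_
        rw [Real.volume_Icc, Real.dist_eq]
        refine ENNReal.ofReal_le_ofReal (le_trans (le_of_eq ?_) (le_abs_self _))
        ring
    have h2 := ENNReal.toReal_mono (by finiteness [hfin y]) hle
    rw [ENNReal.toReal_add (hfin y) (by finiteness), ENNReal.toReal_add (by finiteness)
      (by finiteness), ENNReal.toReal_ofReal dist_nonneg] at h2
    simp only [hg, NNReal.coe_ofNat]
    linarith
  have hr' : r ≠ ∞ := hlt.ne_top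
  have hmem : r.toReal ∈ Set.Icc (g 0) (g n) := by
    constructor
    · have : μ (S ∩ Set.Icc (-0 : ℝ) 0) = 0 := by
        refine measure_mono_null Set.inter_subset_right (le_antisymm ((hμ _).trans ?_) zero_le)
        simp
      simp only [hg, this, ENNReal.toReal_zero]
      exact ENNReal.toReal_nonneg
    · exact ENNReal.toReal_mono (hfin _) hn.le
  obtain ⟨x, -, hx⟩ := intermediate_value_Icc (Nat.cast_nonneg n) hLip.continuous.continuousOn hmem
  exact ⟨S ∩ Set.Icc (-x) x, Set.inter_subset_left, hS.inter measurableSet_Icc,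
    (ENNReal.toReal_eq_toReal_iff' (hfin x) hr').1 hx⟩

theorem pairwise_disjoint_cons {α : Type*} {n : ℕ} {T : Set α} {B : Fin n → Set α}
    (hdis : ∀ i, Disjoint T (B i)) (hB : Pairwise (Function.onFun Disjoint B)) :
    Pairwise (Function.onFun Disjoint (Fin.cons T B : Fin (n + 1) → Set α)) := by
  intro i j hij
  induction i using Fin.cases with
  | zero =>
    induction j using Fin.cases with
    | zero => exact absurd rfl hij
    | succ j => exact hdis j
  | succ i =>
    induction j using Fin.cases with
    | zero => exact (hdis i).symm
    | succ j => exact hB fun h => hij (congrArg _ h)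

variable {α : Type*} [MeasurableSpace α] {μ : Measure α}

theorem DivisibleMeasure.exists_disjoint (hμ : DivisibleMeasure μ) {δ : ℝ≥0∞} (hδ : δ ≠ ∞) (n : ℕ) :
    ∀ S, MeasurableSet S → n * δ ≤ μ S → ∃ B : Fin n → Set α, (∀ j, MeasurableSet (B j)) ∧
      (∀ j, B j ⊆ S) ∧ Pairwise (Function.onFun Disjoint B) ∧ ∀ j, μ (B j) = δ := by
  induction n with
  | zero => exact fun S _ _ => ⟨fun _ => ∅, by simp, by simp, fun i => i.elim0, fun i => i.elim0⟩
  | succ n ih =>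
    intro S hS hn
    have hn' : n * δ + δ ≤ μ S := by
      refine le_trans (le_of_eq ?_) hn
      push_cast
      ring
    obtain ⟨T, hTS, hT, hTδ⟩ := hμ S hS δ (le_trans le_add_self hn')
    obtain ⟨B, hB, hBS, hBd, hBδ⟩ := ih (S \ T) (hS.diff hT) (by
      rw [measure_sdiff hTS hT.nullMeasurableSet (hTδ ▸ hδ), hTδ]
      exact ENNReal.le_sub_of_add_le_right hδ hn')
    refine ⟨Fin.cons T B, ?_, ?_, ?_, ?_⟩
    · intro j
      refine Fin.cases hT hB j
    · intro j
      refine Fin.cases hTS (fun i => (hBS i).trans Set.sdiff_subset) j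
    · exact pairwise_disjoint_cons (fun i => Set.disjoint_sdiff_right.mono_right (hBS i)) hBd
    · intro j
      refine Fin.cases hTδ hBδ j

/-- A nonnegative function dominates step functions on disjoint sets of equal measure whose
integrals approximate its integral. -/
theorem DivisibleMeasure.exists_step_le (hμ : DivisibleMeasure μ) {A : Set α} (hA : MeasurableSet A)
    (hAf : μ A ≠ ∞) (F : α → ℝ≥0∞) {r : ℝ≥0∞} (hr : r < ∫⁻ x in A, F x ∂μ) :
    ∃ δ₀ : ℝ≥0∞, 0 < δ₀ ∧ ∀ δ, 0 < δ → δ < δ₀ → ∃ (n : ℕ) (B : Fin n → Set α) (c : Fin n → ℝ≥0),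
      (∀ j, MeasurableSet (B j)) ∧ (∀ j, B j ⊆ A) ∧ Pairwise (Function.onFun Disjoint B) ∧
      (∀ j, μ (B j) = δ) ∧ (∀ j, ∀ x ∈ B j, (c j : ℝ≥0∞) ≤ F x) ∧ r < ∑ j, (c j : ℝ≥0∞) * δ := by
  rw [lintegral_eq_nnreal] at hr
  obtain ⟨φ, hφ⟩ := lt_iSup_iff.1 hr
  obtain ⟨hφF, hφr⟩ := lt_iSup_iff.1 hφ
  rw [SimpleFunc.map_lintegral] at hφr
  have hS : ∀ x, MeasurableSet (φ ⁻¹' {x} ∩ A) := fun x => (φ.measurableSet_fiber x).inter hA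
  have hrest : ∀ x, μ.restrict A (φ ⁻¹' {x}) = μ (φ ⁻¹' {x} ∩ A) := fun x =>
    Measure.restrict_apply (φ.measurableSet_fiber x)
  simp only [hrest] at hφr
  have hSf : ∀ x, μ (φ ⁻¹' {x} ∩ A) ≠ ∞ := fun x =>
    ((measure_mono Set.inter_subset_right).trans_lt hAf.lt_top).ne
  set I := ∑ x ∈ φ.range, (x : ℝ≥0∞) * μ (φ ⁻¹' {x} ∩ A) with hI
  -- Packing a fibre of `φ` with sets of measure `δ` wastes measure at most `δ`, so the integral
  -- drops by at most `M * δ`. The summand `1` makes `M` nonzero, so that it can serve as a divisor.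
  set M : ℝ≥0 := 1 + ∑ x ∈ φ.range, x with hM
  have hM0 : (M : ℝ≥0∞) ≠ 0 := by
    simp [hM]
  refine ⟨(I - r) / M, ENNReal.div_pos (tsub_pos_of_lt hφr).ne' ENNReal.coe_ne_top, ?_⟩
  intro δ hδ hδlt
  have hIf : I ≠ ∞ := by
    rw [hI]
    exact ENNReal.sum_ne_top.2 fun x _ => ENNReal.mul_ne_top ENNReal.coe_ne_top (hSf x)
  have hδf : δ ≠ ∞ := hδlt.ne_top
  set k : ℝ≥0 → ℕ := fun x => ⌊(μ (φ ⁻¹' {x} ∩ A) / δ).toReal⌋₊ with hk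
  have hqf : ∀ x, μ (φ ⁻¹' {x} ∩ A) / δ ≠ ∞ := fun x => (ENNReal.div_lt_top (hSf x) hδ.ne').ne
  have hk1 : ∀ x, k x * δ ≤ μ (φ ⁻¹' {x} ∩ A) := fun x => by
    rw [← ENNReal.le_div_iff_mul_le (Or.inl hδ.ne') (Or.inl hδf)]
    rw [← ENNReal.ofReal_toReal (hqf x), ← ENNReal.ofReal_natCast]
    exact ENNReal.ofReal_le_ofReal (Nat.floor_le ENNReal.toReal_nonneg)
  have hk2 : ∀ x, μ (φ ⁻¹' {x} ∩ A) ≤ k x * δ + δ := fun x => by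
    have : μ (φ ⁻¹' {x} ∩ A) / δ ≤ (k x + 1 : ℕ) := by
      rw [← ENNReal.ofReal_toReal (hqf x), ← ENNReal.ofReal_natCast]
      refine ENNReal.ofReal_le_ofReal ?_
      push_cast
      exact (Nat.lt_floor_add_one _).le
    rw [ENNReal.div_le_iff_le_mul (Or.inl hδ.ne') (Or.inl hδf)] at this
    refine this.trans (le_of_eq ?_)
    push_cast
    ring
  choose P hP hPS hPd hPδ using fun x => hμ.exists_disjoint hδf (k x) _ (hS x) (hk1 x)
  let ι := (x : φ.range) × Fin (k x)
  let e : Fin (Fintype.card ι) ≃ ι := (Fintype.equivFin ι).symm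
  refine ⟨Fintype.card ι, fun j => P (e j).1 (e j).2, fun j => (e j).1, fun j => hP _ _,
    fun j => (hPS _ _).trans Set.inter_subset_right, ?_, fun j => hPδ _ _, ?_, ?_⟩
  · intro i j hij
    have hne : e i ≠ e j := fun h => hij (e.injective h)
    change Disjoint (P (e i).1 (e i).2) (P (e j).1 (e j).2)
    generalize e i = p at hne
    generalize e j = q at hne
    obtain ⟨x, p⟩ := p
    obtain ⟨y, q⟩ := q
    by_cases hxy : x = y
    · subst hxy
      exact hPd x fun h => hne (congrArg (Sigma.mk x) h)
    · refine Set.disjoint_left.2 fun z hz hz' => hxy (Subtype.ext ?_)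
      have h1 : φ z = x := ((hPS x p) hz).1
      have h2 : φ z = y := ((hPS y q) hz').1
      exact h1.symm.trans h2
  · intro j x hx
    have h1 : φ x = (e j).1 := ((hPS _ _) hx).1
    exact (congrArg ENNReal.ofNNReal h1).symm.trans_le (hφF x)
  · have hsum : ∑ j, (((e j).1 : ℝ≥0) : ℝ≥0∞) * δ = ∑ x ∈ φ.range, (x : ℝ≥0∞) * (k x * δ) := by
      rw [e.sum_comp (fun p : ι => ((p.1 : ℝ≥0) : ℝ≥0∞) * δ), Fintype.sum_sigma]
      simp only [Finset.sum_const, Finset.card_univ, Fintype.card_fin, nsmul_eq_mul]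
      rw [Finset.sum_coe_sort φ.range (fun x => (k x : ℝ≥0∞) * ((x : ℝ≥0∞) * δ))]
      exact Finset.sum_congr rfl fun x _ => by ring
    rw [hsum]
    have hle : I ≤ ∑ x ∈ φ.range, (x : ℝ≥0∞) * (k x * δ) + M * δ := by
      calc I ≤ ∑ x ∈ φ.range, (x : ℝ≥0∞) * (k x * δ + δ) :=
            Finset.sum_le_sum fun x _ => by gcongr; exact hk2 x
        _ = ∑ x ∈ φ.range, (x : ℝ≥0∞) * (k x * δ) + (∑ x ∈ φ.range, (x : ℝ≥0∞)) * δ := by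
            simp only [mul_add, Finset.sum_add_distrib, Finset.sum_mul]
        _ ≤ _ := by
            gcongr
            rw [hM]
            push_cast
            exact le_add_self
    have hlt : M * δ < I - r := by
      rw [mul_comm]
      exact (ENNReal.lt_div_iff_mul_lt (Or.inl hM0) (Or.inl ENNReal.coe_ne_top)).1 hδlt
    have h3 : r + M * δ < I := by
      rw [add_comm]
      exact lt_tsub_iff_right.1 hlt
    exact lt_of_add_lt_add_right (h3.trans_le hle)

theorem card_mul_le_measure {ι : Type*} [Fintype ι] {B : ι → Set α} {A : Set α} {δ : ℝ≥0∞}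
    (hB : ∀ j, MeasurableSet (B j)) (hBA : ∀ j, B j ⊆ A)
    (hd : Pairwise (Function.onFun Disjoint B)) (hδ : ∀ j, μ (B j) = δ) :
    Fintype.card ι * δ ≤ μ A := by
  have : μ (⋃ j, B j) = Fintype.card ι * δ := by
    rw [measure_iUnion hd hB, tsum_fintype]
    simp [hδ]
  rw [← this]
  exact measure_mono (Set.iUnion_subset hBA)

/-- Once `μ A / N` is below the threshold of `exists_step_le`, what remains of `A` is cut into sets
of the same measure carrying the value `0`. The pieces then fill `A` up to a null set, so the values
can be permuted cyclically. -/
theorem DivisibleMeasure.exists_equipartition_le (hμ : DivisibleMeasure μ) {A : Set α}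
    (hA : MeasurableSet A) (h0 : μ A ≠ 0) (hAf : μ A ≠ ∞) (F : α → ℝ≥0∞) {a : ℝ≥0}
    (ha : a * μ A < ∫⁻ x in A, F x ∂μ) :
    ∃ (N : ℕ) (B : Fin N → Set α) (c : Fin N → ℝ≥0), N ≠ 0 ∧
      (∀ j, MeasurableSet (B j)) ∧ (∀ j, B j ⊆ A) ∧ Pairwise (Function.onFun Disjoint B) ∧
      (∀ j, μ (B j) = μ A / N) ∧ (∀ j, ∀ x ∈ B j, (c j : ℝ≥0∞) ≤ F x) ∧ a * N < ∑ j, c j := by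
  obtain ⟨δ₀, hδ₀, H⟩ := hμ.exists_step_le hA hAf F ha
  obtain ⟨N, hN⟩ := ENNReal.exists_nat_mul_gt hδ₀.ne' hAf
  have hN0 : N ≠ 0 := by
    rintro rfl
    simp at hN
  have hN0' : (N : ℝ≥0∞) ≠ 0 := by exact_mod_cast hN0
  have hNf : (N : ℝ≥0∞) ≠ ∞ := ENNReal.natCast_ne_top N
  set δ := μ A / N with hδ
  have hδ0 : 0 < δ := ENNReal.div_pos h0 hNf
  have hδf : δ ≠ ∞ := (ENNReal.div_lt_top hAf hN0').ne
  have hNδ : N * δ = μ A := ENNReal.mul_div_cancel hN0' hNf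
  obtain ⟨n, B, c, hB, hBA, hBd, hBδ, hc, hsum⟩ := H δ hδ0
    (ENNReal.div_lt_of_lt_mul' hN)
  have hnN : n ≤ N := by
    have h1 := card_mul_le_measure hB hBA hBd hBδ
    rw [← hNδ, Fintype.card_fin] at h1
    exact_mod_cast (ENNReal.mul_le_mul_iff_left hδ0.ne' hδf).1 h1
  have hU : MeasurableSet (⋃ j, B j) := MeasurableSet.iUnion hB
  have hUA : ⋃ j, B j ⊆ A := Set.iUnion_subset hBA
  have hUδ : μ (⋃ j, B j) = n * δ := by
    rw [measure_iUnion hBd hB, tsum_fintype]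
    simp [hBδ]
  obtain ⟨B', hB', hBA', hBd', hBδ'⟩ := hμ.exists_disjoint hδf (N - n) (A \ ⋃ j, B j)
    (hA.diff hU) (by
      rw [measure_sdiff hUA hU.nullMeasurableSet (hUδ ▸ by finiteness), hUδ, ← hNδ]
      refine ENNReal.le_sub_of_add_le_right (by finiteness) (le_of_eq ?_)
      rw [← add_mul, ← Nat.cast_add, Nat.sub_add_cancel hnN])
  let e : Fin N ≃ Fin n ⊕ Fin (N - n) :=
    (finCongr (Nat.add_sub_cancel' hnN).symm).trans finSumFinEquiv.symm
  have hdis : ∀ i j, Disjoint (B i) (B' j) := fun i j =>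
    Set.disjoint_sdiff_right.mono (Set.subset_iUnion B i) (hBA' j)
  refine ⟨N, fun j => Sum.elim B B' (e j), fun j => Sum.elim c (fun _ => 0) (e j), hN0,
    ?_, ?_, ?_, ?_, ?_, ?_⟩
  · intro j
    beta_reduce
    generalize e j = p
    rcases p with i | i
    exacts [hB i, hB' i]
  · intro j
    beta_reduce
    generalize e j = p
    rcases p with i | i
    exacts [hBA i, (hBA' i).trans Set.sdiff_subset]
  · intro i j hij
    have hne : e i ≠ e j := fun h => hij (e.injective h)
    change Disjoint (Sum.elim B B' (e i)) (Sum.elim B B' (e j))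
    generalize e i = p at hne
    generalize e j = q at hne
    rcases p with p | p <;> rcases q with q | q
    · exact hBd fun h => hne (congrArg _ h)
    · exact hdis p q
    · exact (hdis q p).symm
    · exact hBd' fun h => hne (congrArg _ h)
  · intro j
    beta_reduce
    generalize e j = p
    rcases p with i | i
    exacts [hBδ i, hBδ' i]
  · intro j
    beta_reduce
    generalize e j = p
    rcases p with i | i
    · exact hc i
    · simp
  · rw [e.sum_comp (fun p => Sum.elim c (fun _ => 0) p), Fintype.sum_sum_type]
    simp only [Sum.elim_inl, Sum.elim_inr, Finset.sum_const_zero, add_zero]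
    rw [← hNδ, ← Finset.sum_mul, ← mul_assoc] at hsum
    exact_mod_cast lt_of_mul_lt_mul_right hsum zero_le

/-! ### Step functions and their distribution functions -/

/-- The function equal to `c j` on `B j` and to `0` elsewhere, for disjoint sets `B j`. -/
def stepFun {n : ℕ} (B : Fin n → Set α) (c : Fin n → ℂ) : α → ℂ :=
  fun x => ∑ j, (B j).indicator (fun _ => c j) x

section stepFun

variable {n : ℕ} {B : Fin n → Set α} {c : Fin n → ℂ}

omit [MeasurableSpace α] in
theorem stepFun_of_mem (hd : Pairwise (Function.onFun Disjoint B)) {j : Fin n} {x : α}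
    (hx : x ∈ B j) : stepFun B c x = c j := by
  rw [stepFun, Finset.sum_eq_single j]
  · exact Set.indicator_of_mem hx _
  · intro i _ hij
    exact Set.indicator_of_notMem (Set.disjoint_left.1 (hd hij.symm) hx) _
  · simp

omit [MeasurableSpace α] in
theorem stepFun_of_notMem {x : α} (hx : ∀ j, x ∉ B j) : stepFun B c x = 0 :=
  Finset.sum_eq_zero fun j _ => Set.indicator_of_notMem (hx j) _

theorem measurable_stepFun (hB : ∀ j, MeasurableSet (B j)) : Measurable (stepFun B c) :=
  Finset.measurable_sum _ fun j _ => measurable_const.indicator (hB j)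

/-- When the `B j` have equal measure, the right side is invariant under permuting the values and
moving the sets. The condition `0 ≤ s` keeps the zero set of the function out of the level set. -/
theorem measure_lt_norm_stepFun_add (hB : ∀ j, MeasurableSet (B j))
    (hd : Pairwise (Function.onFun Disjoint B)) {D : Set α} (hD : MeasurableSet D)
    (hBD : ∀ j, Disjoint (B j) D) {w : α → ℂ} (hw : Measurable w) {s : ℝ} (hs : 0 ≤ s) :
    μ {x | s < ‖stepFun B c x + D.indicator w x‖} =
      (∑ j, if s < ‖c j‖ then μ (B j) else 0) + μ (D ∩ {x | s < ‖w x‖}) := by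
  have hset : {x | s < ‖stepFun B c x + D.indicator w x‖} =
      (⋃ j, B j ∩ {_x | s < ‖c j‖}) ∪ (D ∩ {x | s < ‖w x‖}) := by
    ext x
    simp only [Set.mem_ofPred_eq, Set.mem_union, Set.mem_iUnion, Set.mem_inter_iff]
    by_cases hx : ∃ j, x ∈ B j
    · obtain ⟨j, hj⟩ := hx
      have hxD : x ∉ D := Set.disjoint_left.1 (hBD j) hj
      rw [stepFun_of_mem hd hj, Set.indicator_of_notMem hxD, add_zero]
      constructor
      · exact fun h => Or.inl ⟨j, hj, h⟩
      · rintro (⟨i, hi, h⟩ | h)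
        · by_cases hij : i = j
          · exact hij ▸ h
          · exact absurd hj (Set.disjoint_left.1 (hd hij) hi)
        · exact absurd h.1 hxD
    · push Not at hx
      rw [stepFun_of_notMem hx, zero_add]
      by_cases hxD : x ∈ D
      · simp [hx, hxD]
      · simp [hx, hxD, hs]
  have hm : MeasurableSet (D ∩ {x | s < ‖w x‖}) :=
    hD.inter (measurableSet_lt measurable_const hw.norm)
  rw [hset, measure_union _ hm, measure_iUnion _ fun j => (hB j).inter (MeasurableSet.const _),
    tsum_fintype]
  · congr 1
    refine Finset.sum_congr rfl fun j _ => ?_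
    split_ifs with h <;> simp [h]
  · intro i j hij
    exact (hd hij).mono Set.inter_subset_left Set.inter_subset_left
  · refine Set.disjoint_iUnion_left.2 fun j => ?_
    exact (hBD j).mono Set.inter_subset_left Set.inter_subset_left

end stepFun

/-! ### Elements of `E` up to null sets, and symmetry for step functions -/

namespace BanachIdealSpace

variable {E : BanachIdealSpace μ}

theorem toL0_congr {f g : E} (h : f = g) : toL0 f =ᵐ[μ] toL0 g := by rw [h]

theorem coe_add (f g : E) : ⇑(toL0 (f + g)) =ᵐ[μ] fun x => toL0 f x + toL0 g x :=
  AEEqFun.coeFn_add (toL0 f) (toL0 g)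

theorem coe_sub (f g : E) : ⇑(toL0 (f - g)) =ᵐ[μ] fun x => toL0 f x - toL0 g x :=
  AEEqFun.coeFn_sub (toL0 f) (toL0 g)

theorem coe_smul (c : ℂ) (f : E) : ⇑(toL0 (c • f)) =ᵐ[μ] fun x => c * toL0 f x :=
  AEEqFun.coeFn_smul c (toL0 f)

theorem coe_zero : ⇑(toL0 (0 : E)) =ᵐ[μ] fun _ => 0 :=
  AEEqFun.coeFn_zero

theorem coe_sum {ι : Type*} (s : Finset ι) (f : ι → E) :
    ⇑(toL0 (∑ i ∈ s, f i)) =ᵐ[μ] fun x => ∑ i ∈ s, toL0 (f i) x := by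
  classical
  induction s using Finset.induction_on with
  | empty => simpa using coe_zero
  | insert a s ha ih =>
    simp only [Finset.sum_insert ha]
    filter_upwards [coe_add (f a) (∑ i ∈ s, f i), ih] with x h1 h2
    rw [h1, h2]

theorem ext_ae {f g : E} (h : toL0 f =ᵐ[μ] toL0 g) : f = g :=
  Subtype.ext (AEEqFun.ext h)

theorem measurable_coe (f : E) : Measurable (toL0 f) := (toL0 f).measurable

theorem norm_le_of_ae {f g : E} (h : ∀ᵐ x ∂μ, ‖toL0 f x‖ ≤ ‖toL0 g x‖) : ‖f‖ ≤ ‖g‖ :=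
  (E.ideal g (toL0 f) h).2

theorem norm_congr_ae {f g : E} (h : ∀ᵐ x ∂μ, ‖toL0 f x‖ = ‖toL0 g x‖) : ‖f‖ = ‖g‖ :=
  le_antisymm (norm_le_of_ae (h.mono fun _ hx => hx.le)) (norm_le_of_ae (h.mono fun _ hx => hx.ge))

theorem exists_of_le {u : α → ℂ} (hu : Measurable u) {f : E}
    (h : ∀ᵐ x ∂μ, ‖u x‖ ≤ ‖toL0 f x‖) : ∃ g : E, toL0 g =ᵐ[μ] u := by
  have e := AEEqFun.coeFn_mk (μ := μ) u hu.aestronglyMeasurable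
  obtain ⟨hg, -⟩ := E.ideal f (AEEqFun.mk u hu.aestronglyMeasurable) (by
    filter_upwards [e, h] with x h1 h2
    rw [h1]
    exact h2)
  exact ⟨⟨_, hg⟩, e⟩

theorem IsSymmetric.exists_norm_eq (hE : E.IsSymmetric) {f : E} {u : α → ℂ} (hu : Measurable u)
    (h : ∀ s : ℝ, μ {x | s < ‖toL0 f x‖} = μ {x | s < ‖u x‖}) :
    ∃ g : E, toL0 g =ᵐ[μ] u ∧ ‖g‖ = ‖f‖ := by
  have e := AEEqFun.coeFn_mk (μ := μ) u hu.aestronglyMeasurable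
  obtain ⟨hg, hn⟩ := hE f (AEEqFun.mk u hu.aestronglyMeasurable) (fun s => by
    rw [h s]
    refine measure_congr ?_
    filter_upwards [e] with x hx
    exact congrArg (fun z : ℂ => s < ‖z‖) hx.symm)
  exact ⟨⟨_, hg⟩, e, hn⟩

variable (E) in
/-- The characteristic function of a measurable set of finite measure. -/
def ind (A : Set α) (hA : MeasurableSet A) (hAf : μ A ≠ ∞) : E :=
  ⟨_, E.indicator_mem A hA hAf.lt_top⟩

theorem coe_ind {A : Set α} (hA : MeasurableSet A) (hAf : μ A ≠ ∞) :
    ⇑(toL0 (E.ind A hA hAf)) =ᵐ[μ] A.indicator fun _ => (1 : ℂ) :=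
  AEEqFun.coeFn_mk _ _

theorem coe_mulOp {h : α → ℝ} (hm : Measurable h) {C : ℝ} (hC : ∀ x, |h x| ≤ C) (f : E) :
    ⇑(toL0 (mulOp E h hm C hC f)) =ᵐ[μ] fun x => (h x : ℂ) * toL0 f x := by
  have e1 : ⇑(ofRealFun μ h hm) =ᵐ[μ] fun x => (h x : ℂ) := AEEqFun.coeFn_mk _ _
  filter_upwards [e1, AEEqFun.coeFn_mul (ofRealFun μ h hm) (toL0 f)] with x h1 h2
  have : toL0 (mulOp E h hm C hC f) = ofRealFun μ h hm * toL0 f := rfl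
  rw [this, h2, Pi.mul_apply, h1]

variable (E) in
/-- Multiplication by the characteristic function of a measurable set. -/
def proj (A : Set α) (hA : MeasurableSet A) : E →L[ℂ] E :=
  mulOp E (A.indicator fun _ => 1) (measurable_const.indicator hA) 1 fun x => by
    by_cases hx : x ∈ A <;> simp [hx]

theorem coe_proj {A : Set α} (hA : MeasurableSet A) (f : E) :
    ⇑(toL0 (E.proj A hA f)) =ᵐ[μ] A.indicator (toL0 f) := by
  refine (coe_mulOp _ _ f).trans (Filter.Eventually.of_forall fun x => ?_)
  by_cases hx : x ∈ A <;> simp [hx]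

/-- The form in which symmetry is used: values may be permuted among sets of equal measure, and
those sets moved, while the part on `D` stays fixed. This does not change the distribution function.
-/
theorem norm_stepFun_add_congr (hE : E.IsSymmetric) {n : ℕ} {B B' : Fin n → Set α}
    {c c' : Fin n → ℂ} {D : Set α} {w : α → ℂ} {δ : ℝ≥0∞} (hB : ∀ j, MeasurableSet (B j))
    (hd : Pairwise (Function.onFun Disjoint B)) (hδ : ∀ j, μ (B j) = δ)
    (hB' : ∀ j, MeasurableSet (B' j)) (hd' : Pairwise (Function.onFun Disjoint B'))
    (hδ' : ∀ j, μ (B' j) = δ) (hD : MeasurableSet D) (hBD : ∀ j, Disjoint (B j) D)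
    (hBD' : ∀ j, Disjoint (B' j) D) (hw : Measurable w) (σ : Equiv.Perm (Fin n))
    (hσ : ∀ j, c' j = c (σ j)) {f : E}
    (hf : toL0 f =ᵐ[μ] fun x => stepFun B c x + D.indicator w x) :
    ∃ g : E, (toL0 g =ᵐ[μ] fun x => stepFun B' c' x + D.indicator w x) ∧ ‖g‖ = ‖f‖ := by
  refine hE.exists_norm_eq ((measurable_stepFun hB').add (hw.indicator hD)) fun s => ?_
  have h1 : μ {x | s < ‖toL0 f x‖} = μ {x | s < ‖stepFun B c x + D.indicator w x‖} := by
    refine measure_congr ?_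
    filter_upwards [hf] with x hx
    exact congrArg (fun z : ℂ => s < ‖z‖) hx
  rw [h1]
  rcases lt_or_ge s 0 with hs | hs
  · have : ∀ z : ℂ, s < ‖z‖ := fun z => hs.trans_le (norm_nonneg z)
    simp [this]
  · rw [measure_lt_norm_stepFun_add hB hd hD hBD hw hs,
      measure_lt_norm_stepFun_add hB' hd' hD hBD' hw hs]
    congr 1
    rw [← Equiv.sum_comp σ]
    simp only [hδ, hδ', hσ]

end BanachIdealSpace

/-! ### Averaging over a set, and local integrability -/

theorem ae_exists_mem {A : Set α} (hAf : μ A ≠ ∞) {n : ℕ} {B : Fin n → Set α}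
    (hB : ∀ j, MeasurableSet (B j)) (hBA : ∀ j, B j ⊆ A)
    (hd : Pairwise (Function.onFun Disjoint B)) (hsum : ∑ j, μ (B j) = μ A) :
    ∀ᵐ x ∂μ, x ∈ A → ∃ j, x ∈ B j := by
  have hU : MeasurableSet (⋃ j, B j) := MeasurableSet.iUnion hB
  have hUμ : μ (⋃ j, B j) = μ A := by
    rw [measure_iUnion hd hB, tsum_fintype, hsum]
  have : μ (A \ ⋃ j, B j) = 0 := by
    rw [measure_sdiff (Set.iUnion_subset hBA) hU.nullMeasurableSet (hUμ ▸ hAf), hUμ, tsub_self]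
  filter_upwards [measure_eq_zero_iff_ae_notMem.1 this] with x hx hxA
  by_contra h
  exact hx ⟨hxA, fun h' => h (Set.mem_iUnion.1 h')⟩

namespace BanachIdealSpace

variable {E : BanachIdealSpace μ}

/-- Below `|f|` lies a function that on `A` is a step function on `N` pieces of equal measure, with
mean above `a`. Its `N` cyclic shifts all have the same norm, and their average is constant on `A`
because each piece receives every value once. That average dominates `|g|`. -/
theorem norm_le_of_average_lt (hμ : DivisibleMeasure μ) (hE : E.IsSymmetric) {A : Set α}
    (hA : MeasurableSet A) (h0 : μ A ≠ 0) (hAf : μ A ≠ ∞) {f g : E} {a : ℝ≥0}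
    (ha : a * μ A < ∫⁻ x in A, ‖toL0 f x‖ₑ ∂μ) (hgA : ∀ᵐ x ∂μ, x ∈ A → ‖toL0 g x‖ ≤ a)
    (hgc : ∀ᵐ x ∂μ, x ∉ A → ‖toL0 g x‖ ≤ ‖toL0 f x‖) : ‖g‖ ≤ ‖f‖ := by
  obtain ⟨N, B, c, hN, hB, hBA, hd, hδ, hc, hsum⟩ := hμ.exists_equipartition_le hA h0 hAf _ ha
  have : NeZero N := ⟨hN⟩
  have hBD : ∀ j, Disjoint (B j) Aᶜ := fun j => Set.disjoint_compl_right_iff_subset.2 (hBA j)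
  obtain ⟨w, hw⟩ : ∃ w : α → ℂ, w = fun x => (‖toL0 f x‖ : ℂ) := ⟨_, rfl⟩
  have hwm : Measurable w := hw ▸ Complex.measurable_ofReal.comp (measurable_coe f).norm
  have hc' : ∀ j, ∀ x ∈ B j, (c j : ℝ) ≤ ‖toL0 f x‖ := fun j x hx => by
    have := hc j x hx
    rw [enorm_eq_nnnorm] at this
    exact_mod_cast this
  have hbound : ∀ x, ‖stepFun B (fun j => ((c j : ℝ) : ℂ)) x + Aᶜ.indicator w x‖ ≤
      ‖toL0 f x‖ := fun x => by
    by_cases hx : ∃ j, x ∈ B j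
    · obtain ⟨j, hj⟩ := hx
      rw [stepFun_of_mem hd hj, Set.indicator_of_notMem (Set.disjoint_left.1 (hBD j) hj)]
      simpa using hc' j x hj
    · push Not at hx
      rw [stepFun_of_notMem hx, zero_add]
      by_cases hxA : x ∈ A <;> simp [hxA, hw]
  obtain ⟨F₀, hF₀⟩ : ∃ F₀ : E, toL0 F₀ =ᵐ[μ]
      fun x => stepFun B (fun j => ((c j : ℝ) : ℂ)) x + Aᶜ.indicator w x :=
    exists_of_le ((measurable_stepFun hB).add (hwm.indicator hA.compl))
      (Filter.Eventually.of_forall hbound)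
  have hF : ∀ k : Fin N, ∃ F : E, (toL0 F =ᵐ[μ]
      fun x => stepFun B (fun j => ((c (j + k) : ℝ) : ℂ)) x + Aᶜ.indicator w x) ∧ ‖F‖ = ‖F₀‖ :=
    fun k => norm_stepFun_add_congr (c := fun j => ((c j : ℝ) : ℂ)) (w := w) (D := Aᶜ) hE hB hd hδ
      hB hd hδ hA.compl hBD hBD hwm (Equiv.addRight k) (fun j => by rw [Equiv.coe_addRight]) hF₀
  choose F hF hFn using hF
  have hF₀f : ‖F₀‖ ≤ ‖f‖ := by
    refine norm_le_of_ae ?_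
    filter_upwards [hF₀] with x h1
    exact (congrArg norm h1).trans_le (hbound x)
  have hNpos : (0 : ℝ) < N := by exact_mod_cast Nat.pos_of_ne_zero hN
  have hGn : ‖((N : ℂ)⁻¹) • ∑ k, F k‖ ≤ ‖F₀‖ := by
    rw [norm_smul, norm_inv, Complex.norm_natCast]
    calc (N : ℝ)⁻¹ * ‖∑ k, F k‖ ≤ (N : ℝ)⁻¹ * ∑ k, ‖F k‖ := by gcongr; exact norm_sum_le _ _
      _ = ‖F₀‖ := by
        simp only [hFn, Finset.sum_const, Finset.card_univ, Fintype.card_fin, nsmul_eq_mul]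
        field_simp
  have hcover : ∀ᵐ x ∂μ, x ∈ A → ∃ j, x ∈ B j := by
    refine ae_exists_mem hAf hB hBA hd ?_
    simp only [hδ, Finset.sum_const, Finset.card_univ, Fintype.card_fin, nsmul_eq_mul]
    exact ENNReal.mul_div_cancel (by exact_mod_cast hN) (ENNReal.natCast_ne_top N)
  refine (norm_le_of_ae ?_).trans (hGn.trans hF₀f)
  filter_upwards [hgA, hgc, hcover, coe_smul ((N : ℂ)⁻¹) (∑ k, F k), coe_sum Finset.univ F,
    ae_all_iff.2 hF] with x h1 h2 h3 h4 h5 h6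
  rw [h4, h5]
  simp only [h6]
  by_cases hxA : x ∈ A
  · obtain ⟨j, hj⟩ := h3 hxA
    refine (h1 hxA).trans ?_
    rw [Finset.sum_congr rfl fun k _ => by
      rw [stepFun_of_mem hd hj, Set.indicator_of_notMem (Set.disjoint_left.1 (hBD j) hj), add_zero],
      show ∑ k, ((c (j + k) : ℝ) : ℂ) = ∑ k, ((c k : ℝ) : ℂ) from
        Equiv.sum_comp (Equiv.addLeft j) fun k => ((c k : ℝ) : ℂ), norm_mul, norm_inv,
      Complex.norm_natCast, ← Complex.ofReal_sum, Complex.norm_real, Real.norm_of_nonneg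
      (Finset.sum_nonneg fun i _ => (c i).coe_nonneg), inv_mul_eq_div, le_div_iff₀ hNpos]
    exact_mod_cast hsum.le
  · have hx : ∀ j, x ∉ B j := fun j hj => hxA (hBA j hj)
    refine (h2 hxA).trans (le_of_eq ?_)
    simp only [stepFun_of_notMem hx, zero_add, Set.indicator_of_mem (Set.mem_compl hxA),
      Finset.sum_const, Finset.card_univ, Fintype.card_fin, nsmul_eq_mul]
    rw [inv_mul_cancel_left₀ (by exact_mod_cast hN), hw, Complex.norm_real, norm_norm]

/-- Replacing a function on a set by a constant of modulus at most its mean modulus does not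
increase the norm. -/
theorem norm_le_of_average (hμ : DivisibleMeasure μ) (hE : E.IsSymmetric) {A : Set α}
    (hA : MeasurableSet A) (h0 : μ A ≠ 0) (hAf : μ A ≠ ∞) {f g : E} {a : ℝ≥0}
    (ha : a * μ A ≤ ∫⁻ x in A, ‖toL0 f x‖ₑ ∂μ) (hgA : ∀ᵐ x ∂μ, x ∈ A → ‖toL0 g x‖ ≤ a)
    (hgc : ∀ᵐ x ∂μ, x ∉ A → ‖toL0 g x‖ ≤ ‖toL0 f x‖) : ‖g‖ ≤ ‖f‖ := by
  rcases eq_or_ne a 0 with rfl | ha0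
  · refine norm_le_of_ae ?_
    filter_upwards [hgA, hgc] with x h1 h2
    by_cases hx : x ∈ A
    · exact (h1 hx).trans (by simp)
    · exact h2 hx
  -- Scaling `g` by `r < 1` makes the mean inequality strict; then `r` tends to `1`.
  have key : ∀ r : ℝ, r ∈ Set.Ico (0 : ℝ) 1 → r * ‖g‖ ≤ ‖f‖ := by
    rintro r ⟨hr0, hr1⟩
    have h := norm_le_of_average_lt hμ hE hA h0 hAf (f := f) (g := (r : ℂ) • g)
      (a := ⟨r, hr0⟩ * a) (lt_of_lt_of_le ?_ ha) ?_ ?_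
    · rwa [norm_smul, Complex.norm_real, Real.norm_of_nonneg hr0] at h
    · refine (ENNReal.mul_lt_mul_iff_left h0 hAf).2 ?_
      have : (⟨r, hr0⟩ * a : ℝ≥0) < a := mul_lt_of_lt_one_left (pos_iff_ne_zero.2 ha0) hr1
      exact_mod_cast this
    · filter_upwards [hgA, coe_smul (r : ℂ) g] with x h1 h2 hx
      rw [h2, norm_mul, Complex.norm_real, Real.norm_of_nonneg hr0]
      exact mul_le_mul_of_nonneg_left (h1 hx) hr0
    · filter_upwards [hgc, coe_smul (r : ℂ) g] with x h1 h2 hx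
      rw [h2, norm_mul, Complex.norm_real, Real.norm_of_nonneg hr0]
      exact (mul_le_of_le_one_left (norm_nonneg _) hr1.le).trans (h1 hx)
  by_contra! hlt
  have hg : 0 < ‖g‖ := (norm_nonneg f).trans_lt hlt
  obtain ⟨r, hr1, hr2⟩ := exists_between ((div_lt_one hg).2 hlt)
  have h1 := key r ⟨(div_nonneg (norm_nonneg f) hg.le).trans hr1.le, hr2⟩
  rw [div_lt_iff₀ hg] at hr1
  linarith

theorem norm_ind_pos {A : Set α} (hA : MeasurableSet A) (h0 : μ A ≠ 0) (hAf : μ A ≠ ∞) :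
    0 < ‖E.ind A hA hAf‖ := by
  refine norm_pos_iff.2 fun h => h0 ?_
  have h1 := (coe_ind (E := E) hA hAf).symm.trans ((toL0_congr h).trans coe_zero)
  refine measure_eq_zero_iff_ae_notMem.2 ?_
  filter_upwards [h1] with x hx hxA
  simp [hxA] at hx

/-- If the integral over `A` were infinite, averaging would bound the norm of every multiple of
`χ_A` by `‖f‖`. -/
theorem integrableOn (hμ : DivisibleMeasure μ) (hE : E.IsSymmetric) {A : Set α}
    (hA : MeasurableSet A) (hAf : μ A ≠ ∞) (f : E) : IntegrableOn (toL0 f) A μ := by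
  rcases eq_or_ne (μ A) 0 with h0 | h0
  · rw [IntegrableOn, Measure.restrict_eq_zero.2 h0]
    exact integrable_zero_measure
  refine ⟨(measurable_coe f).aestronglyMeasurable, ?_⟩
  rw [hasFiniteIntegral_iff_enorm]
  by_contra htop
  rw [not_lt, top_le_iff] at htop
  have key : ∀ a : ℝ≥0, a * ‖E.ind A hA hAf‖ ≤ ‖f‖ := fun a => by
    have h := norm_le_of_average hμ hE hA h0 hAf (f := f) (g := ((a : ℝ) : ℂ) • E.ind A hA hAf)
      (a := a) (by rw [htop]; exact le_top) ?_ ?_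
    · rwa [norm_smul, Complex.norm_real, Real.norm_of_nonneg a.coe_nonneg] at h
    · filter_upwards [coe_smul ((a : ℝ) : ℂ) (E.ind A hA hAf), coe_ind (E := E) hA hAf]
        with x h1 h2 hx
      rw [h1, h2]
      simp [hx]
    · filter_upwards [coe_smul ((a : ℝ) : ℂ) (E.ind A hA hAf), coe_ind (E := E) hA hAf]
        with x h1 h2 hx
      rw [h1, h2]
      simp [hx]
  have hpos := norm_ind_pos (E := E) hA h0 hAf
  have h2 := key (Real.toNNReal ((‖f‖ + 1) / ‖E.ind A hA hAf‖))
  rw [Real.coe_toNNReal _ (by positivity), div_mul_cancel₀ _ hpos.ne'] at h2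
  linarith

end BanachIdealSpace

/-! ### Hermitian operators to second order -/

/-- Going from `s` to `r` in `N` equal steps costs the factor `(1 + Cd²/N²)^N ≤ exp(Cd²/N)`, which
tends to `1`. Since `r` and `s` are arbitrary, `φ` is constant. -/
theorem le_of_forall_le_one_add_sq_mul {φ : ℝ → ℝ} {C ε : ℝ} (hC : 0 ≤ C) (hε : 0 < ε)
    (h0 : ∀ r, 0 ≤ φ r) (h : ∀ r t, |t| ≤ ε → φ (r + t) ≤ (1 + C * t ^ 2) * φ r) (r s : ℝ) :
    φ r ≤ φ s := by
  set d := r - s with hd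
  have key : ∀ᶠ N : ℕ in Filter.atTop, φ r ≤ Real.exp (C * d ^ 2 / N) * φ s := by
    have hev : ∀ᶠ N : ℕ in Filter.atTop, |d| / N < ε :=
      (tendsto_const_div_atTop_nhds_zero_nat |d|).eventually_lt_const hε
    filter_upwards [hev, Filter.eventually_gt_atTop 0] with N hN hN0
    have hN0' : (0 : ℝ) < N := by exact_mod_cast hN0
    have step : ∀ k : ℕ, φ (s + k * (d / N)) ≤ (1 + C * (d / N) ^ 2) ^ k * φ s := by
      intro k
      induction k with
      | zero => simp
      | succ k ih =>
        have h1 := h (s + k * (d / N)) (d / N) (by rw [abs_div, Nat.abs_cast]; exact hN.le)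
        have h2 : s + (k + 1 : ℕ) * (d / N) = s + k * (d / N) + d / N := by push_cast; ring
        rw [h2, pow_succ', mul_assoc]
        exact h1.trans (mul_le_mul_of_nonneg_left ih (by positivity))
    have h3 := step N
    have h4 : s + N * (d / N) = r := by
      rw [mul_div_cancel₀ _ hN0'.ne', hd]
      ring
    rw [h4] at h3
    refine h3.trans (mul_le_mul_of_nonneg_right ?_ (h0 s))
    calc (1 + C * (d / N) ^ 2) ^ N ≤ Real.exp (C * (d / N) ^ 2) ^ N := by
          gcongr
          rw [add_comm]
          exact Real.add_one_le_exp _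
      _ = Real.exp (C * d ^ 2 / N) := by
          rw [← Real.exp_nat_mul]
          congr 1
          field_simp
  have hlim : Filter.Tendsto (fun N : ℕ => Real.exp (C * d ^ 2 / N) * φ s) Filter.atTop
      (nhds (Real.exp 0 * φ s)) :=
    ((Real.continuous_exp.tendsto 0).comp
      (tendsto_const_div_atTop_nhds_zero_nat (C * d ^ 2))).mul_const _
  simpa using ge_of_tendsto hlim key

section IsHerm

variable {X : Type*} [NormedAddCommGroup X] [NormedSpace ℂ X]

/-- The second order form of hermiticity: `‖1 + i t H‖ ≤ 1 + C t ^ 2` for all real `t`. -/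
def IsHerm (H : X →L[ℂ] X) : Prop :=
  ∃ C : ℝ, 0 ≤ C ∧ ∀ (t : ℝ) (f : X), ‖f + (Complex.I * t) • H f‖ ≤ (1 + C * t ^ 2) * ‖f‖

theorem IsHerm.smul {H : X →L[ℂ] X} (hH : IsHerm H) (r : ℝ) : IsHerm ((r : ℂ) • H) := by
  obtain ⟨C, hC, h⟩ := hH
  refine ⟨C * r ^ 2, by positivity, fun t f => ?_⟩
  have := h (t * r) f
  rw [smul_apply, smul_smul]
  convert this using 2
  · push_cast; ring_nf
  · ring

/-- `1 + it(H + K)` is the midpoint of `1 + 2itH` and `1 + 2itK`. -/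
theorem IsHerm.add {H K : X →L[ℂ] X} (hH : IsHerm H) (hK : IsHerm K) : IsHerm (H + K) := by
  obtain ⟨C, hC, h⟩ := hH
  obtain ⟨D, hD, k⟩ := hK
  refine ⟨2 * C + 2 * D, by positivity, fun t f => ?_⟩
  have h1 := h (2 * t) f
  have h2 := k (2 * t) f
  have h3 : f + (Complex.I * t) • (H + K) f = (2⁻¹ : ℂ) •
      ((f + (Complex.I * (2 * t : ℝ)) • H f) + (f + (Complex.I * (2 * t : ℝ)) • K f)) := by
    rw [add_apply]
    push_cast
    module
  rw [h3, norm_smul, norm_inv, Complex.norm_ofNat]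
  have h4 := norm_add_le (f + (Complex.I * (2 * t : ℝ)) • H f) (f + (Complex.I * (2 * t : ℝ)) • K f)
  linarith

theorem IsHerm.sub {H K : X →L[ℂ] X} (hH : IsHerm H) (hK : IsHerm K) : IsHerm (H - K) := by
  have := hH.add (hK.smul (-1))
  convert this using 1
  ext f
  simp [sub_eq_add_neg]

theorem IsHerm.conj {H U : X →L[ℂ] X} (hH : IsHerm H) (hU : ∀ f, ‖U f‖ = ‖f‖)
    (hUU : ∀ f, U (U f) = f) : IsHerm (U ∘L H ∘L U) := by
  obtain ⟨C, hC, h⟩ := hH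
  refine ⟨C, hC, fun t f => ?_⟩
  have h1 := h t (U f)
  rw [← hU, hU f, map_add, map_smul, hUU, ← hU] at h1
  rw [hU] at h1
  exact h1

variable [CompleteSpace X]

theorem exists_norm_exp_sub_le (H : X →L[ℂ] X) : ∃ C ε : ℝ, 0 ≤ C ∧ 0 < ε ∧ ∀ t : ℝ, |t| ≤ ε →
    ‖NormedSpace.exp ((Complex.I * (t : ℂ)) • H) - (1 + (Complex.I * (t : ℂ)) • H)‖ ≤
      C * t ^ 2 := by
  have h1 := (NormedSpace.exp_hasFPowerSeriesAt_zero (𝕂 := ℂ)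
    (𝔸 := X →L[ℂ] X)).isBigO_sub_partialSum_pow 2
  have h2 : Filter.Tendsto (fun t : ℝ => (Complex.I * (t : ℂ)) • H) (nhds 0) (nhds 0) := by
    have : Continuous fun t : ℝ => (Complex.I * (t : ℂ)) • H := by fun_prop
    simpa using this.tendsto 0
  obtain ⟨c, hc⟩ := (h1.comp_tendsto h2).bound
  obtain ⟨ε, hε, h3⟩ := Metric.eventually_nhds_iff.1 hc
  refine ⟨|c| * ‖H‖ ^ 2, ε / 2, by positivity, by positivity, fun t ht => ?_⟩
  have h4 := h3 (y := t) (by rw [Real.dist_0_eq_abs]; linarith)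
  simp only [Function.comp_apply, zero_add, FormalMultilinearSeries.partialSum,
    Finset.sum_range_succ, Finset.sum_range_zero, NormedSpace.expSeries_apply_eq] at h4
  simp only [Nat.factorial, Nat.cast_one, inv_one, pow_zero, one_smul, pow_one, norm_pow, norm_smul,
    norm_mul, Complex.norm_I, one_mul, Complex.norm_real, Real.norm_eq_abs, mul_one,
    abs_norm, mul_pow, sq_abs] at h4
  refine h4.trans ?_
  nlinarith [le_abs_self c, mul_nonneg (sq_nonneg t) (sq_nonneg ‖H‖)]

theorem isHerm_of_mem_Herm {H : X →L[ℂ] X} (hH : H ∈ Herm X) : IsHerm H := by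
  obtain ⟨C, ε, hC, hε, h⟩ := exists_norm_exp_sub_le H
  refine ⟨C + ‖H‖ / ε, by positivity, fun t f => ?_⟩
  rcases le_or_gt |t| ε with ht | ht
  · have h1 : f + (Complex.I * t) • H f = NormedSpace.exp ((Complex.I * (t : ℂ)) • H) f -
        (NormedSpace.exp ((Complex.I * (t : ℂ)) • H) - (1 + (Complex.I * (t : ℂ)) • H)) f := by
      simp
    have h2 : ‖NormedSpace.exp ((Complex.I * (t : ℂ)) • H) f‖ ≤ 1 * ‖f‖ := by
      rw [← hH t]
      exact ContinuousLinearMap.le_opNorm _ _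
    have h3 := (NormedSpace.exp ((Complex.I * (t : ℂ)) • H) -
      (1 + (Complex.I * (t : ℂ)) • H)).le_of_opNorm_le (h t ht) f
    have h4 : 0 ≤ ‖H‖ / ε * t ^ 2 * ‖f‖ := by positivity
    rw [h1]
    refine (norm_sub_le _ _).trans ?_
    linarith
  -- Away from `0` the trivial bound, linear in `|t|`, suffices since `|t| ≤ t² / ε`. This is the
  -- source of the term `‖H‖ / ε`.
  · have h1 : ‖f + (Complex.I * t) • H f‖ ≤ ‖f‖ + |t| * (‖H‖ * ‖f‖) := by
      refine (norm_add_le _ _).trans ?_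
      rw [norm_smul, norm_mul, Complex.norm_I, one_mul, Complex.norm_real, Real.norm_eq_abs]
      gcongr
      exact H.le_opNorm f
    have h2 : |t| ≤ t ^ 2 / ε := by
      rw [le_div_iff₀ hε, ← sq_abs, sq]
      gcongr
    have h3 : |t| * (‖H‖ * ‖f‖) ≤ t ^ 2 / ε * (‖H‖ * ‖f‖) := by gcongr
    have h4 : 0 ≤ C * t ^ 2 * ‖f‖ := by positivity
    calc _ ≤ _ := h1
      _ ≤ ‖f‖ + t ^ 2 / ε * (‖H‖ * ‖f‖) + C * t ^ 2 * ‖f‖ := by linarith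
      _ = _ := by ring

/-- Along an orbit of the group `exp(itH)` the norm grows by a factor at most `1 + (C + D)t²` per
short step, so it is constant and the group is isometric. Nontriviality gives an isometry norm `1`
rather than `0`. -/
theorem mem_Herm_of_isHerm [Nontrivial X] {H : X →L[ℂ] X} (hH : IsHerm H) : H ∈ Herm X := by
  obtain ⟨C, ε, hC, hε, h⟩ := exists_norm_exp_sub_le H
  obtain ⟨D, hD, k⟩ := hH
  set U : ℝ → X →L[ℂ] X := fun t => NormedSpace.exp ((Complex.I * (t : ℂ)) • H) with hU
  have hadd : ∀ s t, U (s + t) = U t ∘L U s := fun s t => by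
    have hc : Commute ((Complex.I * (t : ℂ)) • H) ((Complex.I * (s : ℂ)) • H) :=
      ((Commute.refl H).smul_left _).smul_right _
    have he : (Complex.I * ((s + t : ℝ) : ℂ)) • H =
        (Complex.I * (t : ℂ)) • H + (Complex.I * (s : ℂ)) • H := by
      push_cast
      module
    simp only [hU, he]
    have : NormedAlgebra ℚ (X →L[ℂ] X) := NormedAlgebra.restrictScalars ℚ ℂ _
    exact NormedSpace.exp_add_of_commute hc
  have hstep : ∀ f (s t : ℝ), |t| ≤ ε → ‖U (s + t) f‖ ≤ (1 + (C + D) * t ^ 2) * ‖U s f‖ := by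
    intro f s t ht
    rw [hadd, ContinuousLinearMap.comp_apply]
    have h1 : U t (U s f) = (U t - (1 + (Complex.I * (t : ℂ)) • H)) (U s f) +
        (U s f + (Complex.I * (t : ℂ)) • H (U s f)) := by
      simp
    rw [h1]
    have h2 := (U t - (1 + (Complex.I * (t : ℂ)) • H)).le_of_opNorm_le (h t ht) (U s f)
    have h3 := k t (U s f)
    refine (norm_add_le _ _).trans ?_
    linarith
  have hU0 : ∀ f, U 0 f = f := fun f => by simp [hU]
  have hiso : ∀ t f, ‖U t f‖ = ‖f‖ := fun t f => by
    have h1 := le_of_forall_le_one_add_sq_mul (φ := fun s => ‖U s f‖) (by positivity) hε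
      (fun _ => norm_nonneg _) (hstep f)
    have h2 := le_antisymm (h1 t 0) (h1 0 t)
    simpa only [hU0] using h2
  intro t
  refine le_antisymm (ContinuousLinearMap.opNorm_le_bound _ zero_le_one fun f => ?_) ?_
  · rw [one_mul]
    exact (hiso t f).le
  · obtain ⟨f, hf⟩ := exists_ne (0 : X)
    have h1 := (U t).le_opNorm f
    rw [hiso] at h1
    exact le_of_mul_le_mul_right (by rwa [one_mul]) (norm_pos_iff.2 hf)

end IsHerm

/-! ### Hermitian 2×2 matrices for a symmetric norm -/

section SymmGauge

/-- A nonnegative function of two complex variables which is midpoint convex, symmetric, and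
increasing in the moduli of its arguments. -/
structure IsSymmGauge (N : ℂ → ℂ → ℝ) : Prop where
  nonneg : ∀ a b, 0 ≤ N a b
  mono : ∀ {a b a' b'}, ‖a‖ ≤ ‖a'‖ → ‖b‖ ≤ ‖b'‖ → N a b ≤ N a' b'
  symm : ∀ a b, N a b = N b a
  unbounded : ∀ R, ∃ a : ℝ, R < N a 0
  midpoint : ∀ a b a' b', N (2⁻¹ * (a + a')) (2⁻¹ * (b + b')) ≤ 2⁻¹ * (N a b + N a' b')

/-- The matrix with zero diagonal, entry `β` in the first row and `α` in the second row is
Hermitian with respect to `N`, up to second order. -/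
def PairHerm (N : ℂ → ℂ → ℝ) (α β : ℂ) : Prop :=
  ∃ C : ℝ, 0 ≤ C ∧ ∀ (t : ℝ) (a b : ℂ), N (a + Complex.I * t * (β * b))
    (b + Complex.I * t * (α * a)) ≤ (1 + C * t ^ 2) * N a b

variable {N : ℂ → ℂ → ℝ} {α β : ℂ}

theorem IsSymmGauge.congr (hN : IsSymmGauge N) {a b a' b' : ℂ} (ha : ‖a‖ = ‖a'‖)
    (hb : ‖b‖ = ‖b'‖) : N a b = N a' b' :=
  le_antisymm (hN.mono ha.le hb.le) (hN.mono ha.ge hb.ge)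

theorem PairHerm.add (hN : IsSymmGauge N) {α' β' : ℂ} (h : PairHerm N α β)
    (h' : PairHerm N α' β') : PairHerm N (α + α') (β + β') := by
  obtain ⟨C, hC, h⟩ := h
  obtain ⟨D, hD, k⟩ := h'
  refine ⟨2 * C + 2 * D, by positivity, fun t a b => ?_⟩
  have h1 := h (2 * t) a b
  have h2 := k (2 * t) a b
  have h3 := hN.midpoint (a + Complex.I * (2 * t : ℝ) * (β * b))
    (b + Complex.I * (2 * t : ℝ) * (α * a)) (a + Complex.I * (2 * t : ℝ) * (β' * b))
    (b + Complex.I * (2 * t : ℝ) * (α' * a))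
  have h4 : ∀ a b β β' : ℂ, 2⁻¹ * ((a + Complex.I * (2 * t : ℝ) * (β * b)) +
      (a + Complex.I * (2 * t : ℝ) * (β' * b))) = a + Complex.I * t * ((β + β') * b) :=
    fun a b β β' => by push_cast; ring
  rw [h4, h4] at h3
  linarith

/-- Conjugation by a diagonal unitary matrix, which the gauge does not see. The next two lemmas use
the exchange of coordinates and complex conjugation in the same way. -/
theorem PairHerm.phase (hN : IsSymmGauge N) (h : PairHerm N α β) {ω : ℂ} (hω : ‖ω‖ = 1) :
    PairHerm N (ω * α) ((starRingEnd ℂ) ω * β) := by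
  obtain ⟨C, hC, h⟩ := h
  refine ⟨C, hC, fun t a b => ?_⟩
  have hωω : ω * (starRingEnd ℂ) ω = 1 := by
    rw [Complex.mul_conj, Complex.normSq_eq_norm_sq, hω]
    simp
  have hω' : ‖(starRingEnd ℂ) ω‖ = 1 := by rw [RCLike.norm_conj, hω]
  have h1 := h t a ((starRingEnd ℂ) ω * b)
  rw [hN.congr (a := a) (b := (starRingEnd ℂ) ω * b) (a' := a) (b' := b) rfl
    (by rw [norm_mul, hω', one_mul])] at h1
  refine le_trans (le_of_eq (hN.congr ?_ ?_)) h1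
  · congr 1
    ring
  · have h2 : b + Complex.I * t * (ω * α * a) =
        ω * ((starRingEnd ℂ) ω * b + Complex.I * t * (α * a)) := by
      linear_combination -b * hωω
    rw [h2, norm_mul, hω, one_mul]

theorem PairHerm.swap_neg (hN : IsSymmGauge N) (h : PairHerm N α β) : PairHerm N (-β) (-α) := by
  obtain ⟨C, hC, h⟩ := h
  refine ⟨C, hC, fun t a b => ?_⟩
  have h1 := h (-t) b a
  rw [hN.symm, hN.symm b a, neg_sq] at h1
  convert h1 using 2 <;> · push_cast; ring

theorem PairHerm.conj (hN : IsSymmGauge N) (h : PairHerm N α β) :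
    PairHerm N (-(starRingEnd ℂ) α) (-(starRingEnd ℂ) β) := by
  obtain ⟨C, hC, h⟩ := h
  refine ⟨C, hC, fun t a b => ?_⟩
  have h1 := h t ((starRingEnd ℂ) a) ((starRingEnd ℂ) b)
  rw [hN.congr (RCLike.norm_conj a) (RCLike.norm_conj b)] at h1
  refine le_trans (le_of_eq (hN.congr ?_ ?_)) h1
  all_goals
    rw [← RCLike.norm_conj]
    congr 1
    simp

theorem PairHerm.smul (h : PairHerm N α β) (r : ℝ) : PairHerm N (r * α) (r * β) := by
  obtain ⟨C, hC, h⟩ := h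
  refine ⟨C * r ^ 2, by positivity, fun t a b => ?_⟩
  have h1 := h (t * r) a b
  convert h1 using 2 <;> · push_cast; ring

/-- The matrix is skew-adjoint: `i` times it has the positive eigenvalue `p = ‖α‖`, with eigenvector
`(1, z)`. The second-order bound would make `N` constant along the ray through that vector, where it
is unbounded. -/
theorem IsSymmGauge.not_pairHerm_neg_conj (hN : IsSymmGauge N) (hα : α ≠ 0) :
    ¬ PairHerm N α (-(starRingEnd ℂ) α) := by
  rintro ⟨C, hC, h⟩
  set p := ‖α‖ with hp
  have hp0 : 0 < p := norm_pos_iff.2 hα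
  have hpc : (p : ℂ) ≠ 0 := by exact_mod_cast hp0.ne'
  set z : ℂ := Complex.I * α / p with hz
  set φ : ℝ → ℝ := fun s => N (Real.exp s : ℝ) ((Real.exp s : ℝ) * z) with hφ
  have hstep : ∀ r t : ℝ, |t| ≤ 1 → φ (r + t) ≤ (1 + (C * (4 / p ^ 2)) * t ^ 2) * φ r := by
    intro r t ht
    -- This parameter multiplies the eigenvector by exactly `exp t`.
    have h1 := h ((Real.exp t - 1) / p) (Real.exp r : ℝ) ((Real.exp r : ℝ) * z)
    have hαα : (starRingEnd ℂ) α * α = (p : ℂ) ^ 2 := by rw [Complex.conj_mul', hp]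
    have e1 : ((Real.exp r : ℝ) : ℂ) + Complex.I * (((Real.exp t - 1) / p : ℝ) : ℂ) *
        (-(starRingEnd ℂ) α * ((Real.exp r : ℝ) * z)) = (Real.exp (r + t) : ℝ) := by
      rw [Real.exp_add, hz]
      push_cast
      field_simp
      linear_combination (-(Complex.exp t - 1) * Complex.I ^ 2) * hαα -
        (Complex.exp t - 1) * p ^ 2 * Complex.I_mul_I
    have e2 : ((Real.exp r : ℝ) : ℂ) * z + Complex.I * (((Real.exp t - 1) / p : ℝ) : ℂ) *
        (α * (Real.exp r : ℝ)) = (Real.exp (r + t) : ℝ) * z := by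
      rw [Real.exp_add, hz]
      push_cast
      field_simp
      ring
    rw [e1, e2] at h1
    refine h1.trans (mul_le_mul_of_nonneg_right ?_ (hN.nonneg _ _))
    have h2 : (Real.exp t - 1) ^ 2 ≤ 4 * t ^ 2 := by
      have := pow_le_pow_left₀ (abs_nonneg _) (Real.abs_exp_sub_one_le ht) 2
      rw [sq_abs, mul_pow, sq_abs] at this
      linarith
    rw [div_pow]
    have h3 : (Real.exp t - 1) ^ 2 / p ^ 2 ≤ 4 * t ^ 2 / p ^ 2 := by gcongr
    calc 1 + C * ((Real.exp t - 1) ^ 2 / p ^ 2) ≤ 1 + C * (4 * t ^ 2 / p ^ 2) := by gcongr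
      _ = _ := by ring
  have hle := le_of_forall_le_one_add_sq_mul (φ := φ) (by positivity) one_pos
    (fun _ => hN.nonneg _ _) hstep
  obtain ⟨a, ha⟩ := hN.unbounded (φ 0)
  have h4 : N a 0 ≤ φ |a| := by
    refine hN.mono ?_ (by rw [norm_zero]; exact norm_nonneg _)
    rw [Complex.norm_real, Complex.norm_real, Real.norm_eq_abs, Real.norm_of_nonneg
      (Real.exp_pos _).le]
    linarith [Real.add_one_le_exp |a|]
  exact absurd (h4.trans (hle _ _)) (not_le.2 ha)

/-- After multiplying by a phase `ω`, adding the negated transpose and then the conjugate leaves the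
entries `±2iy` with `y = Im(ω(α + conj β))`. It remains to find `ω` with `y ≠ 0`, which is possible
unless `α + conj β = 0`. -/
theorem PairHerm.rotation (hN : IsSymmGauge N) (h : PairHerm N α β) (hα : α ≠ 0) :
    PairHerm N Complex.I (-Complex.I) := by
  have key : ∀ ω : ℂ, ‖ω‖ = 1 → (ω * (α + (starRingEnd ℂ) β)).im ≠ 0 →
      PairHerm N Complex.I (-Complex.I) := by
    intro ω hω hne
    have h1 := h.phase hN hω
    have h2 := h1.add hN (h1.swap_neg hN)
    have h3 := (h2.add hN (h2.conj hN)).smul (2 * (ω * (α + (starRingEnd ℂ) β)).im)⁻¹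
    set y := (ω * (α + (starRingEnd ℂ) β)).im with hy
    have h4 : (2 * y * Complex.I : ℂ) = ω * (α + (starRingEnd ℂ) β) -
        (starRingEnd ℂ) (ω * (α + (starRingEnd ℂ) β)) := by
      rw [Complex.sub_conj, ← hy]
      push_cast
      rfl
    simp only [map_mul, map_add, map_neg, Complex.conj_conj] at h3 h4
    have hy' : (y : ℂ) ≠ 0 := by exact_mod_cast hne
    convert h3 using 1
    · push_cast
      rw [eq_inv_mul_iff_mul_eq₀ (by simpa using hne), h4]
      ring
    · push_cast
      rw [eq_inv_mul_iff_mul_eq₀ (by simpa using hne), mul_neg, h4]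
      ring
  rcases eq_or_ne (α + (starRingEnd ℂ) β) 0 with h0 | h0
  · -- here `α = -conj β`, and the matrix has a purely imaginary eigenvalue
    have hβ : β = -(starRingEnd ℂ) α := by
      have := congrArg (starRingEnd ℂ) (eq_neg_of_add_eq_zero_right h0)
      rwa [Complex.conj_conj, map_neg] at this
    exact absurd (hβ ▸ h) (hN.not_pairHerm_neg_conj hα)
  -- The phase for which `ω(α + conj β)` is `i` times its modulus.
  · refine key (Complex.I * (starRingEnd ℂ) (α + (starRingEnd ℂ) β) / ‖α + (starRingEnd ℂ) β‖)
      ?_ ?_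
    · rw [norm_div, norm_mul, Complex.norm_I, RCLike.norm_conj, Complex.norm_real, norm_norm,
        one_mul, div_self (norm_ne_zero_iff.2 h0)]
    · have h5 : Complex.I * (starRingEnd ℂ) (α + (starRingEnd ℂ) β) / ‖α + (starRingEnd ℂ) β‖ *
          (α + (starRingEnd ℂ) β) = ((‖α + (starRingEnd ℂ) β‖ : ℝ) : ℂ) * Complex.I := by
        have h6 : (‖α + (starRingEnd ℂ) β‖ : ℂ) ≠ 0 := by exact_mod_cast norm_ne_zero_iff.2 h0
        rw [div_mul_eq_mul_div, mul_assoc, Complex.conj_mul', div_eq_iff h6]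
        ring
      rw [h5]
      simpa using h0

/-- For these entries, `1 + itM` is a real matrix; with parameter `-tan t` it is the rotation by `t`
divided by `cos t`. As `0 < cos t ≤ 1` the division only increases `N`, and `tan² t ≤ 4t²` for `|t|
≤ 1`, so `N` is constant on real circles. -/
theorem IsSymmGauge.eq_of_rotation (hN : IsSymmGauge N) (h : PairHerm N Complex.I (-Complex.I))
    (a b : ℝ) : N a b = N (√(a ^ 2 + b ^ 2) : ℝ) 0 := by
  obtain ⟨C, hC, h⟩ := h
  set z : ℂ := ⟨a, b⟩ with hz
  set φ : ℝ → ℝ := fun θ => N ((‖z‖ * Real.cos θ : ℝ) : ℂ) ((‖z‖ * Real.sin θ : ℝ) : ℂ) with hφ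
  have hstep : ∀ r t : ℝ, |t| ≤ 1 → φ (r + t) ≤ (1 + (4 * C) * t ^ 2) * φ r := by
    intro r t ht
    have hcos : 1 / 2 ≤ Real.cos t := by
      have := Real.one_sub_sq_div_two_le_cos (x := t)
      have h2 : t ^ 2 ≤ 1 := by rw [← sq_abs]; exact pow_le_one₀ (abs_nonneg t) ht
      linarith
    have hc0 : 0 < Real.cos t := by linarith
    have h1 := h (-Real.tan t) ((‖z‖ * Real.cos r : ℝ) : ℂ) ((‖z‖ * Real.sin r : ℝ) : ℂ)
    have e1 : ((‖z‖ * Real.cos r : ℝ) : ℂ) + Complex.I * ((-Real.tan t : ℝ) : ℂ) *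
        (-Complex.I * ((‖z‖ * Real.sin r : ℝ) : ℂ)) =
        ((‖z‖ * Real.cos (r + t) / Real.cos t : ℝ) : ℂ) := by
      have : ‖z‖ * Real.cos (r + t) / Real.cos t =
          ‖z‖ * Real.cos r - Real.tan t * (‖z‖ * Real.sin r) := by
        rw [Real.cos_add, Real.tan_eq_sin_div_cos]
        field_simp
      rw [this]
      push_cast
      linear_combination (Complex.tan t * (‖z‖ * Complex.sin r)) * Complex.I_mul_I
    have e2 : ((‖z‖ * Real.sin r : ℝ) : ℂ) + Complex.I * ((-Real.tan t : ℝ) : ℂ) *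
        (Complex.I * ((‖z‖ * Real.cos r : ℝ) : ℂ)) =
        ((‖z‖ * Real.sin (r + t) / Real.cos t : ℝ) : ℂ) := by
      have : ‖z‖ * Real.sin (r + t) / Real.cos t =
          ‖z‖ * Real.sin r + Real.tan t * (‖z‖ * Real.cos r) := by
        rw [Real.sin_add, Real.tan_eq_sin_div_cos]
        field_simp
      rw [this]
      push_cast
      linear_combination (-Complex.tan t * (‖z‖ * Complex.cos r)) * Complex.I_mul_I
    rw [e1, e2] at h1
    have hle : ∀ x : ℝ, ‖(x : ℂ)‖ ≤ ‖((x / Real.cos t : ℝ) : ℂ)‖ := fun x => by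
      rw [Complex.norm_real, Complex.norm_real, norm_div, Real.norm_of_nonneg hc0.le]
      exact le_div_self (norm_nonneg _) hc0 (Real.cos_le_one t)
    refine ((hN.mono (hle _) (hle _)).trans h1).trans
      (mul_le_mul_of_nonneg_right ?_ (hN.nonneg _ _))
    have htan : Real.tan t ^ 2 ≤ 4 * t ^ 2 := by
      rw [Real.tan_eq_sin_div_cos, div_pow, div_le_iff₀ (by positivity)]
      have hs : Real.sin t ^ 2 ≤ t ^ 2 := by
        rw [← sq_abs, ← sq_abs t]
        exact pow_le_pow_left₀ (abs_nonneg _) Real.abs_sin_le_abs 2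
      have hc2 : 1 / 4 ≤ Real.cos t ^ 2 := by nlinarith
      nlinarith [sq_nonneg t]
    rw [neg_sq]
    nlinarith
  have hle := le_of_forall_le_one_add_sq_mul (φ := φ) (by positivity) one_pos
    (fun _ => hN.nonneg _ _) hstep
  have h2 := le_antisymm (hle z.arg 0) (hle 0 z.arg)
  simp only [hφ, Complex.norm_mul_cos_arg, Complex.norm_mul_sin_arg, Real.cos_zero, mul_one,
    Real.sin_zero, mul_zero, Complex.ofReal_zero] at h2
  rw [h2, Complex.norm_eq_sqrt_sq_add_sq]

end SymmGauge

/-! ### Compressing a Hermitian operator to two sets -/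

namespace BanachIdealSpace

variable {E : BanachIdealSpace μ}

theorem norm_sub_two_smul_proj {A : Set α} (hA : MeasurableSet A) (f : E) :
    ‖f - (2 : ℂ) • E.proj A hA f‖ = ‖f‖ := by
  refine norm_congr_ae ?_
  filter_upwards [coe_sub f ((2 : ℂ) • E.proj A hA f), coe_smul 2 (E.proj A hA f), coe_proj hA f]
    with x h1 h2 h3
  rw [h1, h2, h3]
  by_cases hx : x ∈ A
  · rw [Set.indicator_of_mem hx, ← norm_neg]
    congr 1
    ring
  · rw [Set.indicator_of_notMem hx, mul_zero, sub_zero]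

theorem proj_eq_zero {A : Set α} (hA : MeasurableSet A) {f : E}
    (h : ∀ᵐ x ∂μ, x ∈ A → toL0 f x = 0) : E.proj A hA f = 0 := by
  refine ext_ae ?_
  filter_upwards [coe_proj hA f, h, coe_zero (E := E)] with x h1 h2 h3
  rw [h1, h3]
  by_cases hx : x ∈ A
  · rw [Set.indicator_of_mem hx, h2 hx]
  · rw [Set.indicator_of_notMem hx]

theorem proj_eq_self {A : Set α} (hA : MeasurableSet A) {f : E}
    (h : ∀ᵐ x ∂μ, x ∉ A → toL0 f x = 0) : E.proj A hA f = f := by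
  refine ext_ae ?_
  filter_upwards [coe_proj hA f, h] with x h1 h2
  rw [h1]
  by_cases hx : x ∈ A
  · rw [Set.indicator_of_mem hx]
  · rw [Set.indicator_of_notMem hx, h2 hx]

theorem proj_disjoint {A B : Set α} (hA : MeasurableSet A) (hB : MeasurableSet B)
    (hAB : Disjoint A B) (f : E) : E.proj A hA (E.proj B hB f) = 0 := by
  refine proj_eq_zero hA ?_
  filter_upwards [coe_proj hB f] with x h1 hx
  rw [h1, Set.indicator_of_notMem (Set.disjoint_left.1 hAB hx)]

/-- This is half of `H - UHU` for the isometric involution `U = 1 - 2P`: the off-diagonal part of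
`H` with respect to `A` and its complement. -/
theorem isHerm_commutator_part {H : E →L[ℂ] E} (hH : IsHerm H) {A : Set α} (hA : MeasurableSet A) :
    IsHerm (E.proj A hA ∘L H + H ∘L E.proj A hA - (2 : ℂ) • (E.proj A hA ∘L H ∘L E.proj A hA)) := by
  set P := E.proj A hA with hP
  have hPP : ∀ f, P (P f) = P f := fun f => proj_eq_self hA (by
    filter_upwards [coe_proj hA f] with x h1 hx
    rw [h1, Set.indicator_of_notMem hx])
  have hU : ∀ f, (ContinuousLinearMap.id ℂ E - (2 : ℂ) • P) f = f - (2 : ℂ) • P f := fun f => rfl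
  have h1 := hH.conj (U := ContinuousLinearMap.id ℂ E - (2 : ℂ) • P)
    (fun f => by rw [hU]; exact norm_sub_two_smul_proj hA f)
    (fun f => by
      rw [hU, hU, map_sub, map_smul, hPP]
      module)
  have h2 := (hH.sub h1).smul 2⁻¹
  convert h2 using 1
  ext1 f
  simp only [ContinuousLinearMap.comp_apply, add_apply, sub_apply, smul_apply,
    ContinuousLinearMap.id_apply, map_sub, map_smul]
  push_cast
  module

/-- The part of a Hermitian operator interchanging two disjoint sets is Hermitian. -/
theorem isHerm_cross {H : E →L[ℂ] E} (hH : IsHerm H) {A B : Set α} (hA : MeasurableSet A)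
    (hB : MeasurableSet B) (hAB : Disjoint A B) :
    IsHerm (E.proj A hA ∘L H ∘L E.proj B hB + E.proj B hB ∘L H ∘L E.proj A hA) := by
  -- Taking the off-diagonal part for `A` and then for `B` leaves only the two blocks between them.
  have h := isHerm_commutator_part (isHerm_commutator_part hH hA) hB
  convert h using 1
  ext1 f
  simp only [ContinuousLinearMap.comp_apply, add_apply, sub_apply, smul_apply, map_add, map_sub,
    map_smul, proj_disjoint hA hB hAB, proj_disjoint hB hA hAB.symm, map_zero, smul_zero, sub_zero,
    add_zero, zero_add]
  exact add_comm _ _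

/-- Replacing a function on a set by its mean does not increase the norm. -/
theorem norm_le_of_eq_average (hμ : DivisibleMeasure μ) (hE : E.IsSymmetric) {A : Set α}
    (hA : MeasurableSet A) (h0 : μ A ≠ 0) (hAf : μ A ≠ ∞) {f g : E} {z : ℂ}
    (hz : μ.real A * z = ∫ x in A, toL0 f x ∂μ) (hgA : ∀ᵐ x ∂μ, x ∈ A → toL0 g x = z)
    (hgc : ∀ᵐ x ∂μ, x ∉ A → toL0 g x = toL0 f x) : ‖g‖ ≤ ‖f‖ := by
  refine norm_le_of_average hμ hE hA h0 hAf (a := ‖z‖₊) ?_ ?_ ?_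
  · have h1 := enorm_integral_le_lintegral_enorm (μ := μ.restrict A) (toL0 f)
    rw [← hz, enorm_mul] at h1
    refine le_trans (le_of_eq ?_) h1
    rw [mul_comm, enorm_eq_nnnorm z]
    congr 1
    rw [← ofReal_norm, Complex.norm_real, Real.norm_of_nonneg measureReal_nonneg, measureReal_def,
      ENNReal.ofReal_toReal hAf]
  · filter_upwards [hgA] with x h1 hx
    rw [h1 hx, coe_nnnorm]
  · filter_upwards [hgc] with x h1 hx
    rw [h1 hx]

section Pair

variable {A B : Set α} (hA : MeasurableSet A) (hB : MeasurableSet B) (hAf : μ A ≠ ∞)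
  (hBf : μ B ≠ ∞)

/-- The norm of a function equal to `a` on `A`, to `b` on `B` and to `w` elsewhere. -/
def pairNorm (w : E) (a b : ℂ) : ℝ := ‖a • E.ind A hA hAf + b • E.ind B hB hBf + w‖

theorem coe_pair (w : E) (a b : ℂ) :
    ⇑(toL0 (a • E.ind A hA hAf + b • E.ind B hB hBf + w)) =ᵐ[μ]
      fun x => a * A.indicator (fun _ => 1) x + b * B.indicator (fun _ => 1) x + toL0 w x := by
  filter_upwards [coe_add (a • E.ind A hA hAf + b • E.ind B hB hBf) w,
    coe_add (a • E.ind A hA hAf) (b • E.ind B hB hBf), coe_smul a (E.ind A hA hAf),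
    coe_smul b (E.ind B hB hBf), coe_ind (E := E) hA hAf, coe_ind (E := E) hB hBf]
    with x h1 h2 h3 h4 h5 h6
  rw [h1, h2, h3, h4, h5, h6]

include hA hB in
theorem isSymmGauge_pairNorm (hE : E.IsSymmetric) (hAB : Disjoint A B) (hm : μ A = μ B)
    (h0 : μ A ≠ 0) {w : E} (hw : ∀ᵐ x ∂μ, x ∈ A ∪ B → toL0 w x = 0) :
    IsSymmGauge (pairNorm hA hB hAf hBf w) where
  nonneg a b := norm_nonneg _
  mono {a b a' b'} ha hb := by
    refine norm_le_of_ae ?_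
    filter_upwards [coe_pair hA hB hAf hBf w a b, coe_pair hA hB hAf hBf w a' b', hw] with x h1 h2 h3
    rw [h1, h2]
    by_cases hxA : x ∈ A
    · have hxB := Set.disjoint_left.1 hAB hxA
      simpa [hxA, hxB, h3 (Or.inl hxA)] using ha
    · by_cases hxB : x ∈ B
      · simpa [hxA, hxB, h3 (Or.inr hxB)] using hb
      · simp [hxA, hxB]
  unbounded R := by
    have hpos := norm_ind_pos (E := E) hA h0 hAf
    refine ⟨(|R| + 1) / ‖E.ind A hA hAf‖, ?_⟩
    set a := (|R| + 1) / ‖E.ind A hA hAf‖ with ha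
    have ha0 : 0 ≤ a := by positivity
    have h4 : ‖(a : ℂ) • E.ind A hA hAf‖ ≤ pairNorm hA hB hAf hBf w a 0 := by
      refine norm_le_of_ae ?_
      filter_upwards [coe_pair hA hB hAf hBf w a 0, hw, coe_smul (a : ℂ) (E.ind A hA hAf),
        coe_ind (E := E) hA hAf] with x h1 h3 h5 h6
      rw [h1, h5, h6]
      by_cases hxA : x ∈ A
      · simp [hxA, h3 (Or.inl hxA)]
      · simp [hxA]
    rw [norm_smul, Complex.norm_real, Real.norm_of_nonneg ha0, ha, div_mul_cancel₀ _ hpos.ne'] at h4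
    linarith [le_abs_self R]
  symm a b := by
    have hd : Pairwise (Function.onFun Disjoint ![A, B]) := by
      intro i j hij
      fin_cases i <;> fin_cases j
      · exact absurd rfl hij
      · exact hAB
      · exact hAB.symm
      · exact absurd rfl hij
    have hms : ∀ j, MeasurableSet (![A, B] j) := by
      intro j
      fin_cases j
      exacts [hA, hB]
    have hδ : ∀ j, μ (![A, B] j) = μ A := by
      intro j
      fin_cases j
      exacts [rfl, hm.symm]
    have hD : ∀ j, Disjoint (![A, B] j) (A ∪ B)ᶜ := by
      intro j
      rw [Set.disjoint_compl_right_iff_subset]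
      fin_cases j
      exacts [Set.subset_union_left, Set.subset_union_right]
    have hst : ∀ a b : ℂ, (toL0 (a • E.ind A hA hAf + b • E.ind B hB hBf + w)) =ᵐ[μ]
        fun x => stepFun ![A, B] ![a, b] x + (A ∪ B)ᶜ.indicator (toL0 w) x := fun a b => by
      filter_upwards [coe_pair hA hB hAf hBf w a b, hw] with x h1 h3
      rw [h1, stepFun, Fin.sum_univ_two]
      by_cases hxA : x ∈ A
      · have hxB := Set.disjoint_left.1 hAB hxA
        simp [hxA, hxB, h3 (Or.inl hxA)]
      · by_cases hxB : x ∈ B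
        · simp [hxA, hxB, h3 (Or.inr hxB)]
        · simp [hxA, hxB]
    obtain ⟨g, hg, hgn⟩ := norm_stepFun_add_congr hE (c' := ![b, a]) hms hd hδ hms hd hδ
      (hA.union hB).compl hD hD (measurable_coe w) (Equiv.swap 0 1) (by
        intro j
        fin_cases j <;> simp) (hst a b)
    rw [pairNorm, ← hgn, pairNorm]
    exact congrArg norm (ext_ae (hg.trans (hst b a).symm))
  midpoint a b a' b' := by
    have h1 : (2⁻¹ * (a + a')) • E.ind A hA hAf + (2⁻¹ * (b + b')) • E.ind B hB hBf + w =
        (2⁻¹ : ℂ) • ((a • E.ind A hA hAf + b • E.ind B hB hBf + w) +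
          (a' • E.ind A hA hAf + b' • E.ind B hB hBf + w)) := by
      module
    rw [pairNorm, h1, norm_smul, norm_inv, Complex.norm_ofNat]
    gcongr
    exact norm_add_le _ _

/-- The cross part of `H` ignores `w` and sends `aχ_A + bχ_B` to functions on `A` and `B`. Averaging
the perturbed vector over `A`, then over `B`, does not increase its norm and replaces these
functions by constants, whose coefficients are the matrix entries. -/
theorem pairHerm_of_isHerm (hμ : DivisibleMeasure μ) (hE : E.IsSymmetric) {H : E →L[ℂ] E}
    (hH : IsHerm H) (hAB : Disjoint A B) (hm : μ A = μ B) (h0 : μ A ≠ 0) {w : E}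
    (hw : ∀ᵐ x ∂μ, x ∈ A ∪ B → toL0 w x = 0) :
    PairHerm (pairNorm hA hB hAf hBf w)
      ((∫ x in B, toL0 (H (E.ind A hA hAf)) x ∂μ) / μ.real A)
      ((∫ x in A, toL0 (H (E.ind B hB hBf)) x ∂μ) / μ.real A) := by
  set p := ∫ x in B, toL0 (H (E.ind A hA hAf)) x ∂μ with hp
  set q := ∫ x in A, toL0 (H (E.ind B hB hBf)) x ∂μ with hq
  obtain ⟨C, hC, h⟩ := isHerm_cross hH hA hB hAB
  refine ⟨C, hC, fun t a b => ?_⟩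
  set f := a • E.ind A hA hAf + b • E.ind B hB hBf + w with hf
  have hmr : μ.real A = μ.real B := by rw [measureReal_def, measureReal_def, hm]
  have hm0 : (μ.real A : ℂ) ≠ 0 := by
    have := ENNReal.toReal_ne_zero.2 ⟨h0, hAf⟩
    exact_mod_cast this
  have hPA : E.proj A hA f = a • E.ind A hA hAf := by
    refine ext_ae ?_
    filter_upwards [coe_proj hA f, coe_pair hA hB hAf hBf w a b, hw, coe_smul a (E.ind A hA hAf),
      coe_ind (E := E) hA hAf] with x h1 h2 h3 h4 h5
    rw [h1, h4, h5]
    by_cases hxA : x ∈ A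
    · rw [Set.indicator_of_mem hxA, h2]
      have hxB := Set.disjoint_left.1 hAB hxA
      simp [hxA, hxB, h3 (Or.inl hxA)]
    · simp [hxA]
  have hPB : E.proj B hB f = b • E.ind B hB hBf := by
    refine ext_ae ?_
    filter_upwards [coe_proj hB f, coe_pair hA hB hAf hBf w a b, hw, coe_smul b (E.ind B hB hBf),
      coe_ind (E := E) hB hBf] with x h1 h2 h3 h4 h5
    rw [h1, h4, h5]
    by_cases hxB : x ∈ B
    · rw [Set.indicator_of_mem hxB, h2]
      have hxA := Set.disjoint_right.1 hAB hxB
      simp [hxA, hxB, h3 (Or.inr hxB)]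
    · simp [hxB]
  have h1 := h t f
  rw [add_apply, ContinuousLinearMap.comp_apply, ContinuousLinearMap.comp_apply,
    ContinuousLinearMap.comp_apply, ContinuousLinearMap.comp_apply, hPA, hPB, map_smul, map_smul,
    map_smul, map_smul] at h1
  set F₁ := f + (Complex.I * t) • (b • E.proj A hA (H (E.ind B hB hBf)) +
    a • E.proj B hB (H (E.ind A hA hAf))) with hF₁
  have cF₁ : ⇑(toL0 F₁) =ᵐ[μ] fun x => (a * A.indicator (fun _ => 1) x +
      b * B.indicator (fun _ => 1) x + toL0 w x) + Complex.I * t *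
      (b * A.indicator (toL0 (H (E.ind B hB hBf))) x +
        a * B.indicator (toL0 (H (E.ind A hA hAf))) x) := by
    filter_upwards [coe_pair hA hB hAf hBf w a b,
      coe_add f ((Complex.I * t) • (b • E.proj A hA (H (E.ind B hB hBf)) +
        a • E.proj B hB (H (E.ind A hA hAf)))),
      coe_smul (Complex.I * t) (b • E.proj A hA (H (E.ind B hB hBf)) +
        a • E.proj B hB (H (E.ind A hA hAf))),
      coe_add (b • E.proj A hA (H (E.ind B hB hBf))) (a • E.proj B hB (H (E.ind A hA hAf))),
      coe_smul b (E.proj A hA (H (E.ind B hB hBf))),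
      coe_smul a (E.proj B hB (H (E.ind A hA hAf))),
      coe_proj hA (H (E.ind B hB hBf)), coe_proj hB (H (E.ind A hA hAf))]
      with x h1 h2 h3 h4 h5 h6 h7 h8
    rw [h2, h3, h4, h5, h6, h7, h8, ← h1]
  have iA := integrableOn hμ hE hA hAf (H (E.ind B hB hBf))
  have iB := integrableOn hμ hE hB hBf (H (E.ind A hA hAf))
  have icA : Integrable (fun _ => a) (μ.restrict A) := integrableOn_const hAf
  have icB : Integrable (fun _ => b) (μ.restrict B) := integrableOn_const hBf
  set z₁ := a + Complex.I * t * (q / μ.real A * b) with hz₁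
  set z₂ := b + Complex.I * t * (p / μ.real A * a) with hz₂
  -- `F₂` is `F₁` averaged over `A` only; the second average, over `B`, gives the vector of the
  -- goal.
  set F₂ := z₁ • E.ind A hA hAf + (F₁ - E.proj A hA F₁) with hF₂
  have cF₂ : ⇑(toL0 F₂) =ᵐ[μ] fun x => z₁ * A.indicator (fun _ => 1) x +
      (toL0 F₁ x - A.indicator (toL0 F₁) x) := by
    filter_upwards [coe_add (z₁ • E.ind A hA hAf) (F₁ - E.proj A hA F₁),
      coe_smul z₁ (E.ind A hA hAf), coe_ind (E := E) hA hAf, coe_sub F₁ (E.proj A hA F₁),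
      coe_proj hA F₁] with x h1 h2 h3 h4 h5
    rw [h1, h2, h3, h4, h5]
  have hF₂₁ : ‖F₂‖ ≤ ‖F₁‖ := by
    refine norm_le_of_eq_average hμ hE hA h0 hAf (z := z₁) ?_ ?_ ?_
    · have : ∫ x in A, toL0 F₁ x ∂μ =
          ∫ x in A, (a + Complex.I * t * b * toL0 (H (E.ind B hB hBf)) x) ∂μ := by
        refine setIntegral_congr_ae hA ?_
        filter_upwards [cF₁, hw] with x h1 h2 hxA
        have hxB := Set.disjoint_left.1 hAB hxA
        rw [h1]
        simp only [Set.indicator_of_mem hxA, Set.indicator_of_notMem hxB, h2 (Or.inl hxA)]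
        ring
      rw [this, integral_add icA (iA.const_mul _), setIntegral_const,
        integral_const_mul, ← hq, hz₁, Complex.real_smul]
      field_simp
    · filter_upwards [cF₂] with x h1 hxA
      rw [h1]
      simp [hxA]
    · filter_upwards [cF₂] with x h1 hxA
      rw [h1]
      simp [hxA]
  refine le_trans ?_ (hF₂₁.trans h1)
  refine norm_le_of_eq_average hμ hE hB (hm ▸ h0) hBf (z := z₂) ?_ ?_ ?_
  · have : ∫ x in B, toL0 F₂ x ∂μ =
        ∫ x in B, (b + Complex.I * t * a * toL0 (H (E.ind A hA hAf)) x) ∂μ := by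
      refine setIntegral_congr_ae hB ?_
      filter_upwards [cF₁, cF₂, hw] with x h1 h3 h2 hxB
      have hxA := Set.disjoint_right.1 hAB hxB
      rw [h3]
      simp only [Set.indicator_of_mem hxB, Set.indicator_of_notMem hxA, h1, h2 (Or.inr hxB)]
      ring
    rw [this, integral_add icB (iB.const_mul _), setIntegral_const,
      integral_const_mul, ← hp, hz₂, Complex.real_smul, ← hmr]
    field_simp
  · filter_upwards [coe_pair hA hB hAf hBf w z₁ z₂, hw] with x h1 h2 hxB
    have hxA := Set.disjoint_right.1 hAB hxB
    rw [h1]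
    simp [hxA, hxB, h2 (Or.inr hxB)]
  · filter_upwards [coe_pair hA hB hAf hBf w z₁ z₂, cF₁, cF₂, hw] with x h1 h2 h3 h4 hxB
    rw [h1, h3]
    by_cases hxA : x ∈ A
    · simp [hxA, hxB, h4 (Or.inl hxA)]
    · simp [hxA, hxB, h2]

end Pair

end BanachIdealSpace

/-! ### Rotation invariance makes the norm of step functions Euclidean -/

theorem DivisibleMeasure.exists_equipartition (hμ : DivisibleMeasure μ) {A : Set α}
    (hA : MeasurableSet A) (hAf : μ A ≠ ∞) {k : ℕ} (hk : k ≠ 0) :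
    ∃ P : Fin k → Set α, (∀ j, MeasurableSet (P j)) ∧ (∀ j, P j ⊆ A) ∧
      Pairwise (Function.onFun Disjoint P) ∧ (∀ j, μ (P j) = μ A / k) ∧
      (⋃ j, P j) =ᵐ[μ] A := by
  have hk' : (k : ℝ≥0∞) ≠ 0 := by exact_mod_cast hk
  have hmul : k * (μ A / k) = μ A := ENNReal.mul_div_cancel hk' (ENNReal.natCast_ne_top k)
  obtain ⟨P, hP, hPA, hPd, hPδ⟩ := hμ.exists_disjoint (ENNReal.div_lt_top hAf hk').ne k A hA hmul.le
  refine ⟨P, hP, hPA, hPd, hPδ, ?_⟩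
  filter_upwards [ae_exists_mem hAf hP hPA hPd (by simpa [hPδ] using hmul)] with x hx
  exact propext ⟨fun h => Set.iUnion_subset hPA h, fun h => Set.mem_iUnion.2 (hx h)⟩

namespace BanachIdealSpace

variable {E : BanachIdealSpace μ}

theorem exists_coe_stepFun {n : ℕ} {B : Fin n → Set α} (hB : ∀ j, MeasurableSet (B j))
    (hBf : ∀ j, μ (B j) ≠ ∞) (c : Fin n → ℂ) : ∃ f : E, toL0 f =ᵐ[μ] stepFun B c := by
  refine ⟨∑ j, c j • E.ind (B j) (hB j) (hBf j), ?_⟩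
  filter_upwards [coe_sum Finset.univ fun j => c j • E.ind (B j) (hB j) (hBf j),
    ae_all_iff.2 fun j => coe_smul (c j) (E.ind (B j) (hB j) (hBf j)),
    ae_all_iff.2 fun j => coe_ind (E := E) (hB j) (hBf j)] with x h1 h2 h3
  rw [h1, stepFun]
  refine Finset.sum_congr rfl fun j _ => ?_
  rw [h2, h3]
  by_cases hx : x ∈ B j <;> simp [hx]

theorem ind_eq_sum {A : Set α} (hA : MeasurableSet A) (hAf : μ A ≠ ∞) {n : ℕ} {P : Fin n → Set α}
    (hP : ∀ j, MeasurableSet (P j)) (hPA : ∀ j, P j ⊆ A)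
    (hPd : Pairwise (Function.onFun Disjoint P)) (hPf : ∀ j, μ (P j) ≠ ∞)
    (hPu : (⋃ j, P j) =ᵐ[μ] A) : E.ind A hA hAf = ∑ i, E.ind (P i) (hP i) (hPf i) := by
  refine ext_ae ?_
  filter_upwards [coe_ind (E := E) hA hAf, hPu,
    coe_sum Finset.univ fun i => E.ind (P i) (hP i) (hPf i),
    ae_all_iff.2 fun i => coe_ind (E := E) (hP i) (hPf i)] with x h1 h2 h3 h4
  rw [h1, h3]
  simp only [h4]
  by_cases hx : x ∈ A
  · obtain ⟨i, hi⟩ : ∃ i, x ∈ P i := Set.mem_iUnion.1 (h2.mpr hx)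
    rw [Set.indicator_of_mem hx]
    exact (stepFun_of_mem (c := fun _ => 1) hPd hi).symm
  · rw [Set.indicator_of_notMem hx]
    exact (stepFun_of_notMem (c := fun _ => 1) fun i hi => hx (hPA i hi)).symm

variable (E) in
/-- There are two disjoint sets of measure `δ` such that the norm is invariant under rotations in
the plane spanned by their characteristic functions. -/
def HasRotationPair (δ : ℝ≥0∞) : Prop :=
  ∃ (A B : Set α) (hA : MeasurableSet A) (hB : MeasurableSet B) (hAf : μ A ≠ ∞) (hBf : μ B ≠ ∞),
    Disjoint A B ∧ μ A = δ ∧ μ B = δ ∧ ∀ w : E, (∀ᵐ x ∂μ, x ∈ A ∪ B → toL0 w x = 0) →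
      ∀ a b : ℝ, pairNorm hA hB hAf hBf w a b = pairNorm hA hB hAf hBf w (√(a ^ 2 + b ^ 2) : ℝ) 0

/-- The entry between `A` and `B` is the sum of the entries between the pieces of their
equipartitions, so some pair of pieces has a nonzero entry. This works at every scale `μ A / k`. -/
theorem hasRotationPair (hμ : DivisibleMeasure μ) (hE : E.IsSymmetric) {H : E →L[ℂ] E}
    (hH : IsHerm H) {A B : Set α} (hA : MeasurableSet A) (hB : MeasurableSet B) (hAf : μ A ≠ ∞)
    (hAB : Disjoint A B) (hm : μ A = μ B) (h0 : μ A ≠ 0)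
    (hne : ∫ x in B, toL0 (H (E.ind A hA hAf)) x ∂μ ≠ 0) {k : ℕ} (hk : k ≠ 0) :
    E.HasRotationPair (μ A / k) := by
  have hBf : μ B ≠ ∞ := hm ▸ hAf
  have hk' : (k : ℝ≥0∞) ≠ 0 := by exact_mod_cast hk
  have hδf : μ A / k ≠ ∞ := (ENNReal.div_lt_top hAf hk').ne
  have hδ0 : μ A / k ≠ 0 := (ENNReal.div_pos h0 (ENNReal.natCast_ne_top k)).ne'
  obtain ⟨P, hP, hPA, hPd, hPδ, hPu⟩ := hμ.exists_equipartition hA hAf hk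
  obtain ⟨Q, hQ, hQB, hQd, hQδ, hQu⟩ := hμ.exists_equipartition hB hBf hk
  have hPf : ∀ i, μ (P i) ≠ ∞ := fun i => by rwa [hPδ]
  have hQf : ∀ i, μ (Q i) ≠ ∞ := fun i => by rwa [hQδ, ← hm]
  have hsum := ind_eq_sum (E := E) hA hAf hP hPA hPd hPf hPu
  obtain ⟨i, hi⟩ : ∃ i, ∫ x in B, toL0 (H (E.ind (P i) (hP i) (hPf i))) x ∂μ ≠ 0 := by
    by_contra! hall
    refine hne ?_
    rw [hsum, map_sum, integral_congr_ae (ae_restrict_of_ae (coe_sum Finset.univ _)),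
      integral_finsetSum _ fun i _ => integrableOn hμ hE hB hBf _]
    exact Finset.sum_eq_zero fun i _ => hall i
  obtain ⟨j, hj⟩ : ∃ j, ∫ x in Q j, toL0 (H (E.ind (P i) (hP i) (hPf i))) x ∂μ ≠ 0 := by
    by_contra! hall
    refine hi ?_
    rw [← setIntegral_congr_set hQu, integral_iUnion_fintype hQ hQd fun j =>
      integrableOn hμ hE (hQ j) (hQf j) _]
    exact Finset.sum_eq_zero fun j _ => hall j
  have hPQ : Disjoint (P i) (Q j) := hAB.mono (hPA i) (hQB j)
  have hPQm : μ (P i) = μ (Q j) := by rw [hPδ, hQδ, hm]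
  refine ⟨P i, Q j, hP i, hQ j, hPf i, hQf j, hPQ, hPδ i, by rw [hQδ, hm], fun w hw a b => ?_⟩
  have hP0 : μ (P i) ≠ 0 := by rwa [hPδ]
  have hg := isSymmGauge_pairNorm (hP i) (hQ j) (hPf i) (hQf j) hE hPQ hPQm hP0 hw
  have hp := pairHerm_of_isHerm (hP i) (hQ j) (hPf i) (hQf j) hμ hE hH hPQ hPQm hP0 hw
  refine hg.eq_of_rotation (hp.rotation hg (div_ne_zero hj ?_)) a b
  have := ENNReal.toReal_ne_zero.2 ⟨hP0, hPf i⟩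
  exact_mod_cast this

theorem norm_stepFun_congr (hE : E.IsSymmetric) {n : ℕ} {B B' : Fin n → Set α}
    {c : Fin n → ℂ} {δ : ℝ≥0∞} (hB : ∀ j, MeasurableSet (B j))
    (hd : Pairwise (Function.onFun Disjoint B)) (hδ : ∀ j, μ (B j) = δ)
    (hB' : ∀ j, MeasurableSet (B' j)) (hd' : Pairwise (Function.onFun Disjoint B'))
    (hδ' : ∀ j, μ (B' j) = δ) {f g : E} (hf : toL0 f =ᵐ[μ] stepFun B c)
    (hg : toL0 g =ᵐ[μ] stepFun B' c) : ‖f‖ = ‖g‖ := by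
  obtain ⟨g', hg', hn⟩ := norm_stepFun_add_congr (D := ∅) (w := 0) (f := f) (c := c) (c' := c)
    hE hB hd hδ hB' hd' hδ' MeasurableSet.empty (fun j => Set.disjoint_empty _)
    (fun j => Set.disjoint_empty _) measurable_zero 1 (fun j => rfl) (by simpa using hf)
  rw [← hn]
  exact congrArg norm (ext_ae (hg'.trans (by simpa using hg.symm)))

omit [MeasurableSpace α] in
theorem stepFun_cons {n : ℕ} (S : Set α) (B : Fin n → Set α) (c : Fin (n + 1) → ℂ) (x : α) :
    stepFun (Fin.cons S B : Fin (n + 1) → Set α) c x =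
      c 0 * S.indicator (fun _ => 1) x + stepFun B (fun j => c j.succ) x := by
  rw [stepFun, Fin.sum_univ_succ, stepFun]
  by_cases hx : x ∈ S <;> simp [hx]

/-- Induction on the number of sets. By symmetry the first two may be taken to be the rotation pair;
a rotation merges their coefficients into `√(c₀² + c₁²)` on a single set. -/
theorem HasRotationPair.exists_norm_stepFun {δ : ℝ≥0∞} (h : E.HasRotationPair δ)
    (hμ : DivisibleMeasure μ) (hE : E.IsSymmetric) :
    ∃ r : ℝ, 0 ≤ r ∧ ∀ (n : ℕ) (B : Fin n → Set α) (c : Fin n → ℝ) (f : E),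
      (∀ j, MeasurableSet (B j)) → Pairwise (Function.onFun Disjoint B) → (∀ j, μ (B j) = δ) →
      toL0 f =ᵐ[μ] stepFun B (fun j => (c j : ℂ)) → ‖f‖ = r * √(∑ j, c j ^ 2) := by
  obtain ⟨S, T, hS, hT, hSf, hTf, hST, hSδ, hTδ, hrot⟩ := h
  have hδf : δ ≠ ∞ := hSδ ▸ hSf
  refine ⟨‖E.ind S hS hSf‖, norm_nonneg _, fun n => ?_⟩
  induction n with
  | zero =>
    intro B c f hB hd hδ hf
    have : f = 0 := ext_ae (by
      filter_upwards [hf, coe_zero (E := E)] with x h1 h2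
      rw [h1, h2, stepFun, Fin.sum_univ_zero])
    simp [this]
  | succ n ih =>
    intro B c f hB hd hδ hf
    rcases n with - | n
    · rw [norm_stepFun_congr (B' := fun _ => S) (g := (c 0 : ℂ) • E.ind S hS hSf) hE hB hd hδ
        (fun _ => hS) (fun i j hij => absurd (Subsingleton.elim (α := Fin 1) i j) hij) (fun _ => hSδ) hf]
      · rw [norm_smul, Complex.norm_real, Fin.sum_univ_one, Real.sqrt_sq_eq_abs, Real.norm_eq_abs,
          mul_comm]
      · filter_upwards [coe_smul (c 0 : ℂ) (E.ind S hS hSf), coe_ind (E := E) hS hSf] with x h1 h2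
        rw [h1, h2, stepFun, Fin.sum_univ_one]
        by_cases hx : x ∈ S <;> simp [hx]
    -- The given `n + 2` disjoint sets of measure `δ` show that the space outside `S ∪ T` has room
    -- for `n` more.
    · obtain ⟨R, hR, hRS, hRd, hRδ⟩ := hμ.exists_disjoint hδf n (S ∪ T)ᶜ (hS.union hT).compl (by
        have h1 := card_mul_le_measure hB (fun j => Set.subset_univ (B j)) hd hδ
        rw [← measure_add_measure_compl (hS.union hT), measure_union hST hT, hSδ, hTδ,
          Fintype.card_fin] at h1
        refine (ENNReal.add_le_add_iff_left (a := δ + δ) (by finiteness)).1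
          (le_trans (le_of_eq ?_) h1)
        push_cast
        ring)
      have hSR : ∀ i, Disjoint S (R i) := fun i => Set.disjoint_left.2 fun x hx hx' =>
        hRS i hx' (Or.inl hx)
      have hTR : ∀ i, Disjoint T (R i) := fun i => Set.disjoint_left.2 fun x hx hx' =>
        hRS i hx' (Or.inr hx)
      obtain ⟨w, hw⟩ := exists_coe_stepFun (E := E) hR (fun j => (hRδ j).symm ▸ hδf)
        (fun j => (c j.succ.succ : ℂ))
      have hw0 : ∀ᵐ x ∂μ, x ∈ S ∪ T → toL0 w x = 0 := by
        filter_upwards [hw] with x h1 hx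
        rw [h1, stepFun_of_notMem fun j hj => hRS j hj hx]
      have hmeas : ∀ (n : ℕ) (U : Set α) (V : Fin n → Set α), MeasurableSet U →
          (∀ j, MeasurableSet (V j)) →
          ∀ j, MeasurableSet ((Fin.cons U V : Fin (n + 1) → Set α) j) := fun n U V hU hV j =>
        Fin.cases hU hV j
      have hmδ : ∀ (n : ℕ) (U : Set α) (V : Fin n → Set α), μ U = δ → (∀ j, μ (V j) = δ) →
          ∀ j, μ ((Fin.cons U V : Fin (n + 1) → Set α) j) = δ := fun n U V hU hV j =>
        Fin.cases hU hV j
      have hdis : ∀ i, Disjoint S ((Fin.cons T R : Fin (n + 1) → Set α) i) := fun i =>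
        Fin.cases hST hSR i
      rw [norm_stepFun_congr (B' := Fin.cons S (Fin.cons T R))
        (g := (c 0 : ℂ) • E.ind S hS hSf + (c 1 : ℂ) • E.ind T hT hTf + w) hE hB hd hδ
        (hmeas _ _ _ hS (hmeas _ _ _ hT hR))
        (pairwise_disjoint_cons hdis (pairwise_disjoint_cons hTR hRd))
        (hmδ _ _ _ hSδ (hmδ _ _ _ hTδ hRδ)) hf]
      · have h1 := hrot w hw0 (c 0) (c 1)
        rw [pairNorm] at h1
        rw [h1, pairNorm, ih (Fin.cons S R)
          (Fin.cons (√(c 0 ^ 2 + c 1 ^ 2)) fun j => c j.succ.succ) _ (hmeas _ _ _ hS hR)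
          (pairwise_disjoint_cons hSR hRd) (hmδ _ _ _ hSδ hRδ)]
        · congr 2
          simp only [Fin.sum_univ_succ, Fin.cons_zero, Fin.cons_succ]
          rw [Real.sq_sqrt (by positivity), add_assoc]
          rfl
        · filter_upwards [coe_pair (E := E) hS hT hSf hTf w ((√(c 0 ^ 2 + c 1 ^ 2) : ℝ) : ℂ) 0, hw]
            with x h1 h2
          rw [h1, h2, stepFun_cons]
          simp
      · filter_upwards [coe_pair hS hT hSf hTf w (c 0 : ℂ) (c 1 : ℂ), hw] with x h1 h2
        rw [h1, h2, stepFun_cons, stepFun_cons]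
        simp [add_assoc]

variable (E) in
/-- The norm of step functions on disjoint sets of measure `m / k`, for any `k`, is `κ` times their
`L₂`-norm. -/
def StepNormEqL2 (m : ℝ≥0∞) (κ : ℝ) : Prop :=
  ∀ (k n : ℕ) (B : Fin n → Set α) (c : Fin n → ℝ) (f : E), k ≠ 0 →
    (∀ j, MeasurableSet (B j)) → Pairwise (Function.onFun Disjoint B) → (∀ j, μ (B j) = m / k) →
    toL0 f =ᵐ[μ] stepFun B (fun j => (c j : ℂ)) → ‖f‖ = κ * √(∑ j, c j ^ 2 * (m / k).toReal)

/-- The constant from the induction may depend on `k`. Writing `χ_A` as a sum of `k` pieces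
determines it, with the same `κ = ‖χ_A‖ / √(μ A)` for all `k`. -/
theorem exists_stepNormEqL2 (hμ : DivisibleMeasure μ) (hE : E.IsSymmetric) {A : Set α}
    (hA : MeasurableSet A) (h0 : μ A ≠ 0) (hAf : μ A ≠ ∞)
    (h : ∀ k : ℕ, k ≠ 0 → E.HasRotationPair (μ A / k)) :
    ∃ κ : ℝ, 0 < κ ∧ E.StepNormEqL2 (μ A) κ := by
  have hm : 0 < (μ A).toReal := ENNReal.toReal_pos h0 hAf
  have hpos := norm_ind_pos (E := E) hA h0 hAf
  refine ⟨‖E.ind A hA hAf‖ / √(μ A).toReal, by positivity, ?_⟩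
  intro k n B c f hk hB hd hδ hf
  obtain ⟨r, hr, H⟩ := (h k hk).exists_norm_stepFun hμ hE
  obtain ⟨P, hP, hPA, hPd, hPδ, hPu⟩ := hμ.exists_equipartition hA hAf hk
  have h1 := H k P (fun _ => 1) (E.ind A hA hAf) hP hPd hPδ (by
    filter_upwards [coe_ind (E := E) hA hAf, hPu] with x h1 h2
    rw [h1]
    by_cases hx : x ∈ A
    · obtain ⟨i, hi⟩ : ∃ i, x ∈ P i := Set.mem_iUnion.1 (h2.mpr hx)
      rw [Set.indicator_of_mem hx, stepFun_of_mem hPd hi, Complex.ofReal_one]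
    · rw [Set.indicator_of_notMem hx, stepFun_of_notMem fun i hi => hx (hPA i hi)])
  have h2 := H n B c f hB hd hδ hf
  have hk0 : (0 : ℝ) < k := by exact_mod_cast Nat.pos_of_ne_zero hk
  rw [h1, h2, ← Finset.sum_mul, Real.sqrt_mul (Finset.sum_nonneg fun j _ => sq_nonneg _),
    ENNReal.toReal_div, ENNReal.toReal_natCast, Real.sqrt_div hm.le]
  simp only [one_pow, Finset.sum_const, Finset.card_univ, Fintype.card_fin, nsmul_eq_mul, mul_one]
  have h3 : 0 < √(k : ℝ) := Real.sqrt_pos.2 hk0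
  have h4 : 0 < √(μ A).toReal := Real.sqrt_pos.2 hm
  field_simp

end BanachIdealSpace

/-! ### From step functions to all of `E` -/

/-- If a norm dominates a multiple of a smaller norm `l`, and every vector can be approximated for
`l` by vectors of norm at most the same multiple of its `l`-norm, then the norms agree. -/
theorem norm_le_of_forall_approx {X : Type*} [NormedAddCommGroup X] [CompleteSpace X] {l : X → ℝ}
    {κ : ℝ} (hκ : 0 < κ) (hadd : ∀ x y, l (x + y) ≤ l x + l y) (hzero : ∀ x, l x ≤ 0 → x = 0)
    (hl : ∀ x, κ * l x ≤ ‖x‖)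
    (h : ∀ x, ∀ ε > 0, ∃ u, ‖u‖ ≤ κ * l x ∧ l (x - u) ≤ ε) (x : X) : ‖x‖ ≤ κ * l x := by
  have key : ∀ ε > 0, ‖x‖ ≤ κ * l x + κ * (ε * 2) := by
    intro ε hε
    have hεn : ∀ n : ℕ, 0 < ε * (1 / 2) ^ n := fun n => by positivity
    choose u hu1 hu2 using h
    -- `F n` is the remainder after `n` corrections `v 0, …, v (n - 1)`. It is small for `l`, so the
    -- next correction is small in norm and the series of corrections converges.
    let F : ℕ → X := fun n => Nat.rec x (fun n y => y - u y (ε * (1 / 2) ^ n) (hεn n)) n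
    let v : ℕ → X := fun n => u (F n) (ε * (1 / 2) ^ n) (hεn n)
    have hF0 : F 0 = x := rfl
    have hFs : ∀ n, F (n + 1) = F n - v n := fun n => rfl
    have hFl : ∀ n, l (F (n + 1)) ≤ ε * (1 / 2) ^ n := fun n => by
      rw [hFs]
      exact hu2 _ _ _
    have hv0 : ‖v 0‖ ≤ κ * l x := hu1 _ _ _
    have hvs : ∀ n, ‖v (n + 1)‖ ≤ κ * (ε * (1 / 2) ^ n) := fun n =>
      (hu1 _ _ _).trans (mul_le_mul_of_nonneg_left (hFl n) hκ.le)
    have hgeo : HasSum (fun n : ℕ => κ * (ε * (1 / 2 : ℝ) ^ n)) (κ * (ε * 2)) :=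
      (hasSum_geometric_two.mul_left ε).mul_left κ
    have hs1 : Summable fun n => ‖v (n + 1)‖ :=
      Summable.of_nonneg_of_le (fun _ => norm_nonneg _) hvs hgeo.summable
    have hs : Summable fun n => ‖v n‖ := (summable_nat_add_iff 1).1 hs1
    have hpart : ∀ n, ∑ i ∈ Finset.range n, v i = x - F n := by
      intro n
      induction n with
      | zero => simp [hF0]
      | succ n ih =>
        rw [Finset.sum_range_succ, ih, hFs]
        abel
    set g := ∑' n, v n with hg
    have hlim : Filter.Tendsto (fun n => x - F n) Filter.atTop (nhds g) := by
      simpa only [hpart] using hs.of_norm.hasSum.tendsto_sum_nat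
    -- The remainders are only known to vanish for `l`, so the limit is identified through `l`,
    -- which norm convergence controls.
    have hxg : x = g := by
      refine sub_eq_zero.1 (hzero _ ?_)
      have h1 : ∀ n, l (x - g) ≤ ε * (1 / 2) ^ n + κ⁻¹ * ‖x - F (n + 1) - g‖ := fun n => by
        have e : x - g = F (n + 1) + (x - F (n + 1) - g) := by abel
        rw [e]
        refine (hadd _ _).trans (add_le_add (hFl n) ?_)
        rw [le_inv_mul_iff₀ hκ]
        exact hl _
      have h2 : Filter.Tendsto (fun n => ε * (1 / 2 : ℝ) ^ n + κ⁻¹ * ‖x - F (n + 1) - g‖)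
          Filter.atTop (nhds (ε * 0 + κ⁻¹ * 0)) := by
        refine ((tendsto_pow_atTop_nhds_zero_of_lt_one (by norm_num) (by norm_num)).const_mul
          ε).add (Filter.Tendsto.const_mul _ ?_)
        exact (tendsto_iff_norm_sub_tendsto_zero.1 hlim).comp (Filter.tendsto_add_atTop_nat 1)
      simpa using ge_of_tendsto' h2 h1
    calc ‖x‖ = ‖g‖ := by rw [← hxg]
      _ ≤ ∑' n, ‖v n‖ := norm_tsum_le_tsum_norm hs
      _ = ‖v 0‖ + ∑' n, ‖v (n + 1)‖ := hs.tsum_eq_zero_add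
      _ ≤ κ * l x + κ * (ε * 2) := by
        gcongr
        rw [← hgeo.tsum_eq]
        exact hs1.tsum_le_tsum hvs hgeo.summable
  by_contra! hlt
  have h1 := key ((‖x‖ - κ * l x) / (4 * κ)) (div_pos (sub_pos.2 hlt) (by positivity))
  have h2 : κ * ((‖x‖ - κ * l x) / (4 * κ) * 2) = (‖x‖ - κ * l x) / 2 := by
    field_simp
    ring
  rw [h2] at h1
  linarith

theorem eLpNorm_two_sq (f : α → ℂ) : eLpNorm f 2 μ ^ 2 = ∫⁻ x, ‖f x‖ₑ ^ 2 ∂μ := by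
  have h := eLpNorm_nnreal_pow_eq_lintegral (μ := μ) (f := f) (p := 2) two_ne_zero
  simpa using h

theorem exists_lt_setLIntegral [SigmaFinite μ] {F : α → ℝ≥0∞} {r : ℝ≥0∞}
    (hr : r < ∫⁻ x, F x ∂μ) : ∃ A, MeasurableSet A ∧ μ A ≠ ∞ ∧ r < ∫⁻ x in A, F x ∂μ := by
  have h1 := setLIntegral_iUnion_of_directed (μ := μ) F (monotone_spanningSets μ).directed_le
  rw [iUnion_spanningSets, Measure.restrict_univ] at h1
  rw [h1] at hr
  obtain ⟨n, hn⟩ := lt_iSup_iff.1 hr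
  exact ⟨_, measurableSet_spanningSets μ n, (measure_spanningSets_lt_top μ n).ne, hn⟩

theorem lintegral_enorm_stepFun_sq {n : ℕ} {B : Fin n → Set α} {c : Fin n → ℂ} {δ : ℝ≥0∞}
    (hB : ∀ j, MeasurableSet (B j)) (hd : Pairwise (Function.onFun Disjoint B))
    (hδ : ∀ j, μ (B j) = δ) : ∫⁻ x, ‖stepFun B c x‖ₑ ^ 2 ∂μ = ∑ j, ‖c j‖ₑ ^ 2 * δ := by
  have h1 : ∀ x, ‖stepFun B c x‖ₑ ^ 2 = ∑ j, (B j).indicator (fun _ => ‖c j‖ₑ ^ 2) x := by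
    intro x
    by_cases hx : ∃ j, x ∈ B j
    · obtain ⟨j, hj⟩ := hx
      rw [stepFun_of_mem hd hj, Finset.sum_eq_single j]
      · rw [Set.indicator_of_mem hj]
      · intro i _ hij
        exact Set.indicator_of_notMem (Set.disjoint_left.1 (hd hij.symm) hj) _
      · simp
    · push Not at hx
      rw [stepFun_of_notMem hx, Finset.sum_eq_zero fun j _ => Set.indicator_of_notMem (hx j) _]
      simp
  simp only [h1]
  rw [lintegral_finsetSum _ fun j _ => measurable_const.indicator (hB j)]
  simp only [lintegral_indicator (hB _), setLIntegral_const, hδ]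

namespace BanachIdealSpace

variable {E : BanachIdealSpace μ}

/-- A step function below `|f|²` is chosen on sets of measure `m / k` with `k` large; `s` takes the
square roots of its values. -/
theorem StepNormEqL2.exists_approx [SigmaFinite μ] (hμ : DivisibleMeasure μ) {m : ℝ≥0∞} {κ : ℝ}
    (hm0 : m ≠ 0) (hmf : m ≠ ∞) (hκ : 0 < κ) (h : E.StepNormEqL2 m κ) (f : E) {r : ℝ≥0∞}
    (hr : r < ∫⁻ x, ‖toL0 f x‖ₑ ^ 2 ∂μ) :
    ∃ s : E, (∀ᵐ x ∂μ, ‖toL0 s x‖ ≤ ‖toL0 f x‖) ∧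
      ENNReal.ofReal ‖s‖ = ENNReal.ofReal κ * eLpNorm (toL0 s) 2 μ ∧
      r < ∫⁻ x, ‖toL0 s x‖ₑ ^ 2 ∂μ := by
  obtain ⟨A, hA, hAf, hrA⟩ := exists_lt_setLIntegral hr
  obtain ⟨δ₀, hδ₀, H⟩ := hμ.exists_step_le hA hAf _ hrA
  obtain ⟨k, hk⟩ := ENNReal.exists_nat_mul_gt hδ₀.ne' hmf
  have hk0 : k ≠ 0 := by
    rintro rfl
    simp at hk
  obtain ⟨n, B, c, hB, -, hd, hδ, hc, hsum⟩ := H (m / k)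
    (ENNReal.div_pos hm0 (ENNReal.natCast_ne_top k)) (ENNReal.div_lt_of_lt_mul' hk)
  have hδf : m / k ≠ ∞ := (ENNReal.div_lt_top hmf (by exact_mod_cast hk0)).ne
  have hbound : ∀ x, ‖stepFun B (fun j => ((√(c j) : ℝ) : ℂ)) x‖ ≤ ‖toL0 f x‖ := fun x => by
    by_cases hx : ∃ j, x ∈ B j
    · obtain ⟨j, hj⟩ := hx
      rw [stepFun_of_mem hd hj, Complex.norm_real, Real.norm_of_nonneg (Real.sqrt_nonneg _)]
      refine Real.sqrt_le_iff.2 ⟨norm_nonneg _, ?_⟩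
      have := hc j x hj
      rw [enorm_eq_nnnorm] at this
      exact_mod_cast this
    · push Not at hx
      rw [stepFun_of_notMem hx, norm_zero]
      exact norm_nonneg _
  obtain ⟨s, hs⟩ := exists_of_le (E := E) (measurable_stepFun hB) (f := f)
    (Filter.Eventually.of_forall hbound)
  have hsq : ∀ j, ‖((√(c j) : ℝ) : ℂ)‖ₑ ^ 2 = c j := fun j => by
    rw [← ofReal_norm, Complex.norm_real, Real.norm_of_nonneg (Real.sqrt_nonneg _),
      ← ENNReal.ofReal_pow (Real.sqrt_nonneg _), Real.sq_sqrt (c j).coe_nonneg,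
      ENNReal.ofReal_coe_nnreal]
  have hq : ∫⁻ x, ‖toL0 s x‖ₑ ^ 2 ∂μ = ∑ j, (c j : ℝ≥0∞) * (m / k) := by
    rw [← eLpNorm_two_sq, eLpNorm_congr_ae hs, eLpNorm_two_sq, lintegral_enorm_stepFun_sq hB hd hδ]
    simp only [hsq]
  refine ⟨s, ?_, ?_, by rwa [hq]⟩
  · filter_upwards [hs] with x h1
    rw [h1]
    exact hbound x
  · have h1 := h k n B (fun j => √(c j)) s hk0 hB hd hδ hs
    have h2 : 0 ≤ ∑ j, √(c j) ^ 2 * (m / k).toReal := by positivity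
    have h3 : ENNReal.ofReal (∑ j, √(c j) ^ 2 * (m / k).toReal) = eLpNorm (toL0 s) 2 μ ^ 2 := by
      rw [eLpNorm_two_sq, hq, ENNReal.ofReal_sum_of_nonneg fun j _ => by positivity]
      refine Finset.sum_congr rfl fun j _ => ?_
      rw [Real.sq_sqrt (c j).coe_nonneg, ENNReal.ofReal_mul (c j).coe_nonneg,
        ENNReal.ofReal_coe_nnreal, ENNReal.ofReal_toReal hδf]
    rw [h1, ENNReal.ofReal_mul hκ.le]
    congr 1
    refine (ENNReal.pow_right_strictMono two_ne_zero).injective ?_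
    rw [← h3, ← ENNReal.ofReal_pow (Real.sqrt_nonneg _),
      Real.sq_sqrt h2]

theorem StepNormEqL2.mul_eLpNorm_le [SigmaFinite μ] (hμ : DivisibleMeasure μ) {m : ℝ≥0∞} {κ : ℝ}
    (hm0 : m ≠ 0) (hmf : m ≠ ∞) (hκ : 0 < κ) (h : E.StepNormEqL2 m κ) (f : E) :
    ENNReal.ofReal κ * eLpNorm (toL0 f) 2 μ ≤ ENNReal.ofReal ‖f‖ := by
  have hκ0 : ENNReal.ofReal κ ≠ 0 := (ENNReal.ofReal_pos.2 hκ).ne'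
  rw [mul_comm, ← ENNReal.le_div_iff_mul_le (Or.inl hκ0) (Or.inl ENNReal.ofReal_ne_top)]
  by_contra! hlt
  have hlt2 : (ENNReal.ofReal ‖f‖ / ENNReal.ofReal κ) ^ 2 < ∫⁻ x, ‖toL0 f x‖ₑ ^ 2 ∂μ := by
    rw [← eLpNorm_two_sq]
    exact (ENNReal.pow_lt_pow_left_iff two_ne_zero).2 hlt
  obtain ⟨s, hsf, hs, hsr⟩ := h.exists_approx hμ hm0 hmf hκ f hlt2
  rw [← eLpNorm_two_sq] at hsr
  have h1 : eLpNorm (toL0 s) 2 μ ≤ ENNReal.ofReal ‖f‖ / ENNReal.ofReal κ := by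
    rw [ENNReal.le_div_iff_mul_le (Or.inl hκ0) (Or.inl ENNReal.ofReal_ne_top), mul_comm, ← hs]
    exact ENNReal.ofReal_le_ofReal (norm_le_of_ae hsf)
  exact absurd hsr (not_lt.2 (pow_le_pow_left₀ zero_le h1 2))

/-- Give a step function `s` below `|f|` the phase of `f`: then `|f - u| = |f| - |s|`, so `|f - u|²
+ |s|² ≤ |f|²`, and the error is small once `∫ |s|²` is close to `∫ |f|²`. -/
theorem StepNormEqL2.exists_sub_le [SigmaFinite μ] (hμ : DivisibleMeasure μ) {m : ℝ≥0∞} {κ : ℝ}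
    (hm0 : m ≠ 0) (hmf : m ≠ ∞) (hκ : 0 < κ) (h : E.StepNormEqL2 m κ) (f : E) {ε : ℝ≥0∞}
    (hε : ε ≠ 0) : ∃ u : E, ENNReal.ofReal ‖u‖ ≤ ENNReal.ofReal κ * eLpNorm (toL0 f) 2 μ ∧
      eLpNorm (toL0 (f - u)) 2 μ ≤ ε := by
  have hκ0 : ENNReal.ofReal κ ≠ 0 := (ENNReal.ofReal_pos.2 hκ).ne'
  have hfin : eLpNorm (toL0 f) 2 μ ≠ ∞ := fun htop => by
    have := h.mul_eLpNorm_le hμ hm0 hmf hκ f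
    rw [htop, ENNReal.mul_top hκ0, top_le_iff] at this
    exact ENNReal.ofReal_ne_top this
  rcases eq_or_ne (eLpNorm (toL0 f) 2 μ) 0 with h0 | h0
  · refine ⟨0, by simp, ?_⟩
    rw [sub_zero, h0]
    exact zero_le
  set q := ∫⁻ x, ‖toL0 f x‖ₑ ^ 2 ∂μ with hq
  have hqf : q ≠ ∞ := by
    rw [hq, ← eLpNorm_two_sq]
    exact ENNReal.pow_ne_top hfin
  have hq0 : q ≠ 0 := by
    rw [hq, ← eLpNorm_two_sq]
    exact pow_ne_zero 2 h0
  obtain ⟨s, hsf, hs, hsr⟩ := h.exists_approx hμ hm0 hmf hκ f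
    (ENNReal.sub_lt_self hqf hq0 (pow_ne_zero 2 hε))
  -- Where `f` vanishes the quotient is `0 / 0 = 0`, which is harmless since `s` vanishes there too.
  set p : α → ℂ := fun x => (‖toL0 s x‖ : ℂ) * (toL0 f x / ‖toL0 f x‖) with hp
  have hpm : Measurable p :=
    (Complex.measurable_ofReal.comp (measurable_coe s).norm).mul
      ((measurable_coe f).div (Complex.measurable_ofReal.comp (measurable_coe f).norm))
  have hpn : ∀ᵐ x ∂μ, ‖p x‖ = ‖toL0 s x‖ := by
    filter_upwards [hsf] with x h1
    rcases eq_or_ne (toL0 f x) 0 with h2 | h2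
    · rw [h2, norm_zero] at h1
      simp [hp, h2, norm_le_zero_iff.1 h1]
    · have h3 := norm_ne_zero_iff.2 h2
      simp [hp, h3]
  obtain ⟨u, hu⟩ := exists_of_le (E := E) hpm (f := s) (hpn.mono fun x hx => hx.le)
  have hus : ∀ᵐ x ∂μ, ‖toL0 u x‖ = ‖toL0 s x‖ := by
    filter_upwards [hu, hpn] with x h1 h2
    rw [h1, h2]
  refine ⟨u, ?_, ?_⟩
  · rw [norm_congr_ae hus, hs]
    gcongr
    exact eLpNorm_mono_ae hsf
  · have hle : ∀ᵐ x ∂μ, ‖toL0 (f - u) x‖ₑ ^ 2 + ‖toL0 s x‖ₑ ^ 2 ≤ ‖toL0 f x‖ₑ ^ 2 := by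
      filter_upwards [coe_sub f u, hu, hsf] with x h1 h2 h3
      have h4 : ‖toL0 (f - u) x‖ = ‖toL0 f x‖ - ‖toL0 s x‖ := by
        rw [h1, h2, hp]
        rcases eq_or_ne (toL0 f x) 0 with h2 | h2
        · rw [h2, norm_zero] at h3
          simp [h2, norm_le_zero_iff.1 h3]
        · have h5 : (‖toL0 f x‖ : ℂ) ≠ 0 := by exact_mod_cast norm_ne_zero_iff.2 h2
          have h6 : toL0 f x - (‖toL0 s x‖ : ℂ) * (toL0 f x / ‖toL0 f x‖) =
              ((‖toL0 f x‖ - ‖toL0 s x‖ : ℝ) : ℂ) * (toL0 f x / ‖toL0 f x‖) := by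
            push_cast
            field_simp
          rw [h6, norm_mul, norm_div, Complex.norm_real, Complex.norm_real, norm_norm,
            div_self (norm_ne_zero_iff.2 h2), mul_one, Real.norm_of_nonneg (sub_nonneg.2 h3)]
      simp only [← ofReal_norm]
      rw [← ENNReal.ofReal_pow (norm_nonneg _), ← ENNReal.ofReal_pow (norm_nonneg _),
        ← ENNReal.ofReal_pow (norm_nonneg _), ← ENNReal.ofReal_add (by positivity) (by positivity)]
      refine ENNReal.ofReal_le_ofReal ?_
      rw [h4]
      nlinarith [norm_nonneg (toL0 s x)]
    have h1 := lintegral_mono_ae hle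
    rw [lintegral_add_left ((measurable_coe (f - u)).enorm.pow_const 2), ← hq] at h1
    have h2 : eLpNorm (toL0 (f - u)) 2 μ ^ 2 ≤ ε ^ 2 := by
      rw [eLpNorm_two_sq]
      set S := ∫⁻ x, ‖toL0 s x‖ₑ ^ 2 ∂μ with hS
      have hSf : S ≠ ∞ := ((le_add_self.trans h1).trans_lt hqf.lt_top).ne
      have h3 : q ≤ S + ε ^ 2 := tsub_le_iff_right.1 hsr.le
      refine (ENNReal.add_le_add_iff_right hSf).1 (h1.trans (h3.trans (le_of_eq (add_comm _ _))))
    exact (ENNReal.pow_le_pow_left_iff two_ne_zero).1 h2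

theorem StepNormEqL2.normProportionalToL2 [SigmaFinite μ] (hμ : DivisibleMeasure μ) {m : ℝ≥0∞}
    {κ : ℝ} (hm0 : m ≠ 0) (hmf : m ≠ ∞) (hκ : 0 < κ) (h : E.StepNormEqL2 m κ) :
    E.NormProportionalToL2 := by
  have hκ0 : ENNReal.ofReal κ ≠ 0 := (ENNReal.ofReal_pos.2 hκ).ne'
  have hlow := h.mul_eLpNorm_le hμ hm0 hmf hκ
  have hfin : ∀ f : E, eLpNorm (toL0 f) 2 μ ≠ ∞ := fun f htop => by
    have := hlow f
    rw [htop, ENNReal.mul_top hκ0, top_le_iff] at this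
    exact ENNReal.ofReal_ne_top this
  have haes : ∀ f : E, AEStronglyMeasurable (toL0 f) μ := fun f =>
    (measurable_coe f).aestronglyMeasurable
  have hup := norm_le_of_forall_approx (X := E) (l := fun f => (eLpNorm (toL0 f) 2 μ).toReal) hκ
    (fun f g => by
      rw [← ENNReal.toReal_add (hfin f) (hfin g)]
      refine ENNReal.toReal_mono (by finiteness [hfin f, hfin g]) ?_
      rw [eLpNorm_congr_ae (coe_add f g)]
      exact eLpNorm_add_le (haes f) (haes g) (by norm_num))
    (fun f hf => by
      have h1 := (ENNReal.toReal_eq_zero_iff _).1 (le_antisymm hf ENNReal.toReal_nonneg)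
      have h2 := (eLpNorm_eq_zero_iff (haes f) two_ne_zero).1 (h1.resolve_right (hfin f))
      exact ext_ae (h2.trans coe_zero.symm))
    (fun f => by
      have h1 := ENNReal.toReal_mono ENNReal.ofReal_ne_top (hlow f)
      rwa [ENNReal.toReal_mul, ENNReal.toReal_ofReal hκ.le, ENNReal.toReal_ofReal (norm_nonneg f)]
        at h1)
    (fun f ε hε => by
      obtain ⟨u, hu1, hu2⟩ := h.exists_sub_le hμ hm0 hmf hκ f (ENNReal.ofReal_pos.2 hε).ne'
      refine ⟨u, ?_, ENNReal.toReal_le_of_le_ofReal hε.le hu2⟩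
      have h1 := ENNReal.toReal_mono (ENNReal.mul_ne_top ENNReal.ofReal_ne_top (hfin f)) hu1
      rwa [ENNReal.toReal_mul, ENNReal.toReal_ofReal hκ.le, ENNReal.toReal_ofReal (norm_nonneg u)]
        at h1)
  refine ⟨κ, hκ, fun f => le_antisymm ?_ (hlow f)⟩
  refine (ENNReal.ofReal_le_ofReal (hup f)).trans (le_of_eq ?_)
  rw [ENNReal.ofReal_mul hκ.le, ENNReal.ofReal_toReal (hfin f)]

end BanachIdealSpace

/-! ### Operators preserving supports -/

theorem measure_preimage_spanningSetsIndex_ne_top [SigmaFinite μ] (k : ℕ) :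
    μ (spanningSetsIndex μ ⁻¹' {k}) ≠ ∞ := by
  rw [preimage_spanningSetsIndex_singleton]
  exact ((measure_mono (disjointed_subset _ _)).trans_lt (measure_spanningSets_lt_top μ k)).ne

theorem measurableSet_preimage_spanningSetsIndex [SigmaFinite μ] (k : ℕ) :
    MeasurableSet (spanningSetsIndex μ ⁻¹' {k}) :=
  measurableSet_spanningSetsIndex μ (MeasurableSet.singleton k)

namespace BanachIdealSpace

variable {E : BanachIdealSpace μ}

theorem ind_eq_inter_add_sdiff {A C : Set α} (hA : MeasurableSet A) (hC : MeasurableSet C)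
    (hAf : μ A ≠ ∞) : E.ind A hA hAf =
      E.ind (A ∩ C) (hA.inter hC) (measure_ne_top_of_subset Set.inter_subset_left hAf) +
      E.ind (A \ C) (hA.diff hC) (measure_ne_top_of_subset Set.sdiff_subset hAf) := by
  refine ext_ae ?_
  filter_upwards [coe_ind (E := E) hA hAf, coe_ind (E := E) (hA.inter hC)
      (measure_ne_top_of_subset Set.inter_subset_left hAf), coe_ind (E := E) (hA.diff hC)
      (measure_ne_top_of_subset Set.sdiff_subset hAf), coe_add (E.ind (A ∩ C) (hA.inter hC)
      (measure_ne_top_of_subset Set.inter_subset_left hAf)) (E.ind (A \ C) (hA.diff hC)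
      (measure_ne_top_of_subset Set.sdiff_subset hAf))] with x h1 h2 h3 h4
  rw [h1, h4, h2, h3]
  by_cases hxA : x ∈ A <;> by_cases hxC : x ∈ C <;> simp [hxA, hxC]

/-- An operator maps characteristic functions to functions with the same support as soon as its
matrix entries between disjoint sets of equal measure vanish. -/
theorem ae_eq_zero_of_forall_setIntegral_eq_zero (hμ : DivisibleMeasure μ) (hE : E.IsSymmetric)
    {H : E →L[ℂ] E}
    (hloc : ∀ (A B : Set α) (hA : MeasurableSet A) (_ : MeasurableSet B) (hAf : μ A ≠ ∞),
      Disjoint A B → μ A = μ B → μ A ≠ 0 → ∫ x in B, toL0 (H (E.ind A hA hAf)) x ∂μ = 0)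
    {A : Set α} (hA : MeasurableSet A) (hAf : μ A ≠ ∞) :
    ∀ᵐ x ∂μ, x ∉ A → toL0 (H (E.ind A hA hAf)) x = 0 := by
  rcases eq_or_ne (μ A) 0 with h0 | h0
  · have : E.ind A hA hAf = 0 := by
      refine ext_ae ?_
      filter_upwards [coe_ind (E := E) hA hAf, coe_zero (E := E),
        measure_eq_zero_iff_ae_notMem.1 h0] with x h1 h2 h3
      rw [h1, h2, Set.indicator_of_notMem h3]
    rw [this, map_zero]
    filter_upwards [coe_zero (E := E)] with x h1 _
    exact h1
  set g := toL0 (H (E.ind A hA hAf)) with hg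
  have hgi : ∀ B, MeasurableSet B → μ B ≠ ∞ → IntegrableOn g B μ := fun B hB hBf =>
    integrableOn hμ hE hB hBf _
  -- The hypothesis compares sets of equal measure only; cutting `A` into `k` pieces lets it reach
  -- sets `B` of measure `μ A / k`.
  have hint : ∀ (k : ℕ) (B : Set α), k ≠ 0 → MeasurableSet B → Disjoint A B → μ B = μ A / k →
      ∫ x in B, g x ∂μ = 0 := by
    intro k B hk hB hAB hBk
    have hk' : (k : ℝ≥0∞) ≠ 0 := by exact_mod_cast hk
    have hδf : μ A / k ≠ ∞ := (ENNReal.div_lt_top hAf hk').ne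
    have hδ0 : μ A / k ≠ 0 := (ENNReal.div_pos h0 (ENNReal.natCast_ne_top k)).ne'
    obtain ⟨P, hP, hPA, hPd, hPδ, hPu⟩ := hμ.exists_equipartition hA hAf hk
    have hPf : ∀ i, μ (P i) ≠ ∞ := fun i => by rwa [hPδ]
    rw [hg, ind_eq_sum (E := E) hA hAf hP hPA hPd hPf hPu, map_sum,
      integral_congr_ae (ae_restrict_of_ae (coe_sum Finset.univ _)),
      integral_finsetSum _ fun i _ => integrableOn hμ hE hB (by rwa [hBk]) _]
    exact Finset.sum_eq_zero fun i _ => hloc (P i) B (hP i) hB (hPf i) (hAB.mono_left (hPA i))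
      (by rw [hPδ, hBk]) (by rwa [hPδ])
  -- If the set where `Re(θg) > 0` outside `A` had positive measure, it would contain a set of
  -- measure `μ A / k`, over which `g` has integral zero. Using `θ = ±1, ±i` gives `g = 0`.
  have hre : ∀ θ : ℂ, ∀ᵐ x ∂μ, x ∉ A → (θ * g x).re ≤ 0 := by
    intro θ
    have hm : Measurable fun x => (θ * g x).re :=
      Complex.measurable_re.comp ((measurable_coe (H (E.ind A hA hAf))).const_mul θ)
    have hSm : MeasurableSet (Aᶜ ∩ {x | 0 < (θ * g x).re}) :=
      hA.compl.inter (measurableSet_lt measurable_const hm)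
    have hS : μ (Aᶜ ∩ {x | 0 < (θ * g x).re}) = 0 := by
      by_contra hS0
      obtain ⟨k, hk⟩ := ENNReal.exists_nat_mul_gt hS0 hAf
      have hk0 : k ≠ 0 := by
        rintro rfl
        simp at hk
      have hk' : (k : ℝ≥0∞) ≠ 0 := by exact_mod_cast hk0
      obtain ⟨B, hBS, hB, hBk⟩ := hμ _ hSm (μ A / k) (ENNReal.div_lt_of_lt_mul' hk).le
      have hBf : μ B ≠ ∞ := by
        rw [hBk]
        exact (ENNReal.div_lt_top hAf hk').ne
      have hB0 : μ B ≠ 0 := by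
        rw [hBk]
        exact (ENNReal.div_pos h0 (ENNReal.natCast_ne_top k)).ne'
      have h1 := hint k B hk0 hB (Set.disjoint_left.2 fun x hx hx' => (hBS hx').1 hx) hBk
      have h2 : ∫ x in B, (θ * g x).re ∂μ = 0 := by
        have h3 := integral_re ((hgi B hB hBf).const_mul θ)
        rw [integral_const_mul, h1, mul_zero] at h3
        simpa using h3
      have h4 := (setIntegral_eq_zero_iff_of_nonneg_ae (ae_restrict_of_forall_mem hB
        fun x hx => (hBS hx).2.le) ((hgi B hB hBf).const_mul θ).re).1 h2
      refine hB0 ?_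
      rw [Filter.EventuallyEq, ae_restrict_iff' hB] at h4
      refine measure_eq_zero_iff_ae_notMem.2 ?_
      filter_upwards [h4] with x h5 hx
      exact (hBS hx).2.ne' (h5 hx)
    filter_upwards [measure_eq_zero_iff_ae_notMem.1 hS] with x hx hxA
    by_contra! h
    exact hx ⟨hxA, h⟩
  filter_upwards [hre 1, hre (-1), hre Complex.I, hre (-Complex.I)] with x h1 h2 h3 h4 hx
  have h1 := h1 hx
  have h2 := h2 hx
  have h3 := h3 hx
  have h4 := h4 hx
  simp only [one_mul, neg_mul, Complex.neg_re, Complex.I_mul_re] at h1 h2 h3 h4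
  exact Complex.ext (by simpa using le_antisymm h1 (by linarith))
    (by simpa using le_antisymm (by linarith) (by linarith))

/-- An operator preserving supports of characteristic functions acts on them as multiplication by a
function. -/
theorem exists_ae_eq_indicator [SigmaFinite μ] {H : E →L[ℂ] E}
    (hsupp : ∀ (A : Set α) (hA : MeasurableSet A) (hAf : μ A ≠ ∞),
      ∀ᵐ x ∂μ, x ∉ A → toL0 (H (E.ind A hA hAf)) x = 0) :
    ∃ h : α → ℂ, Measurable h ∧ ∀ (A : Set α) (hA : MeasurableSet A) (hAf : μ A ≠ ∞),
      toL0 (H (E.ind A hA hAf)) =ᵐ[μ] A.indicator h := by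
  have hΩ := measurableSet_preimage_spanningSetsIndex (μ := μ)
  have hΩf := measure_preimage_spanningSetsIndex_ne_top (μ := μ)
  set Ω : ℕ → Set α := fun k => spanningSetsIndex μ ⁻¹' {k} with hΩdef
  -- The images of `χ_A` and `χ_{A ∩ C}` differ by the image of `χ_{A \ C}`, which vanishes on `C`.
  -- So the images agree on overlaps and can be glued along a countable partition into sets of
  -- finite measure.
  have hcompat : ∀ (A C : Set α) (hA : MeasurableSet A) (hC : MeasurableSet C) (hAf : μ A ≠ ∞)
      (hCf : μ C ≠ ∞), ∀ᵐ x ∂μ, x ∈ A ∩ C →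
      toL0 (H (E.ind A hA hAf)) x = toL0 (H (E.ind C hC hCf)) x := by
    have aux : ∀ (A C : Set α) (hA : MeasurableSet A) (hC : MeasurableSet C) (hAf : μ A ≠ ∞),
      ∀ᵐ x ∂μ, x ∈ A ∩ C → toL0 (H (E.ind A hA hAf)) x = toL0 (H (E.ind (A ∩ C) (hA.inter hC)
        (measure_ne_top_of_subset Set.inter_subset_left hAf))) x := by
      intro A C hA hC hAf
      have h1 := coe_add (H (E.ind (A ∩ C) (hA.inter hC)
        (measure_ne_top_of_subset Set.inter_subset_left hAf))) (H (E.ind (A \ C) (hA.diff hC)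
        (measure_ne_top_of_subset Set.sdiff_subset hAf)))
      rw [← map_add, ← ind_eq_inter_add_sdiff hA hC hAf] at h1
      filter_upwards [h1, hsupp (A \ C) (hA.diff hC)
        (measure_ne_top_of_subset Set.sdiff_subset hAf)] with x h1 h2 hx
      rw [h1, h2 fun h => h.2 hx.2, add_zero]
    intro A C hA hC hAf hCf
    have h2 := aux C A hC hA hCf
    simp only [Set.inter_comm C A] at h2
    filter_upwards [aux A C hA hC hAf, h2] with x h1 h2 hx
    rw [h1 hx, h2 hx]
  obtain ⟨v, hv⟩ : ∃ v : ℕ → E, ∀ k, v k = H (E.ind (Ω k) (hΩ k) (hΩf k)) := ⟨_, fun _ => rfl⟩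
  refine ⟨fun x => toL0 (v (spanningSetsIndex μ x)) x, ?_, ?_⟩
  · have h1 : Measurable fun p : ℕ × α => toL0 (v p.1) p.2 :=
      measurable_from_prod_countable_right fun k => measurable_coe (v k)
    exact h1.comp ((measurableSet_spanningSetsIndex μ).prodMk measurable_id)
  · intro A hA hAf
    filter_upwards [hsupp A hA hAf, ae_all_iff.2 fun k => hcompat A (Ω k) hA (hΩ k) hAf (hΩf k)]
      with x h1 h2
    by_cases hx : x ∈ A
    · rw [Set.indicator_of_mem hx, hv]
      exact h2 _ ⟨hx, rfl⟩
    · rw [Set.indicator_of_notMem hx, h1 hx]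

theorem ae_norm_le_of_multiplier [SigmaFinite μ] {T : E →L[ℂ] E} {u : α → ℂ} (hu : Measurable u)
    (hT : ∀ (A : Set α) (hA : MeasurableSet A) (hAf : μ A ≠ ∞),
      toL0 (T (E.ind A hA hAf)) =ᵐ[μ] A.indicator u) {c : ℝ} (hc : ∀ f, ‖T f‖ ≤ c * ‖f‖) :
    ∀ᵐ x ∂μ, ‖u x‖ ≤ c := by
  have key : ∀ k n : ℕ, ∀ᵐ x ∂μ, x ∈ spanningSetsIndex μ ⁻¹' {k} → ‖u x‖ ≤ c + 1 / (n + 1) := by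
    intro k n
    set A := spanningSetsIndex μ ⁻¹' {k} ∩ {x | c + 1 / (n + 1) < ‖u x‖} with hAdef
    have hA : MeasurableSet A := (measurableSet_preimage_spanningSetsIndex k).inter
      (measurableSet_lt measurable_const hu.norm)
    have hAf : μ A ≠ ∞ := measure_ne_top_of_subset Set.inter_subset_left
      (measure_preimage_spanningSetsIndex_ne_top k)
    have hA0 : μ A = 0 := by
      by_contra h0
      have hpos := norm_ind_pos (E := E) hA h0 hAf
      have hc0 : 0 ≤ c := nonneg_of_mul_nonneg_left ((norm_nonneg _).trans (hc _)) hpos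
      have h1 : ‖((c + 1 / (n + 1) : ℝ) : ℂ) • E.ind A hA hAf‖ ≤ ‖T (E.ind A hA hAf)‖ := by
        refine norm_le_of_ae ?_
        filter_upwards [coe_smul ((c + 1 / (n + 1) : ℝ) : ℂ) (E.ind A hA hAf),
          coe_ind (E := E) hA hAf, hT A hA hAf] with x h1 h2 h3
        rw [h1, h2, h3]
        by_cases hx : x ∈ A
        · rw [Set.indicator_of_mem hx, Set.indicator_of_mem hx, mul_one, Complex.norm_real,
            Real.norm_of_nonneg (by positivity)]
          exact hx.2.le
        · rw [Set.indicator_of_notMem hx, Set.indicator_of_notMem hx, mul_zero]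
      rw [norm_smul, Complex.norm_real, Real.norm_of_nonneg (by positivity)] at h1
      have h2 := le_of_mul_le_mul_right (h1.trans (hc _)) hpos
      have h3 : (0 : ℝ) < 1 / (n + 1) := by positivity
      linarith
    filter_upwards [measure_eq_zero_iff_ae_notMem.1 hA0] with x hx hxk
    by_contra! h
    exact hx ⟨hxk, h⟩
  filter_upwards [ae_all_iff.2 fun k => ae_all_iff.2 (key k)] with x hx
  refine le_of_forall_pos_le_add fun ε hε => ?_
  obtain ⟨n, hn⟩ := exists_nat_one_div_lt hε
  exact (hx _ n rfl).trans (by linarith)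

theorem isHerm_mulOp {h : α → ℝ} (hm : Measurable h) {C : ℝ} (hC : ∀ x, |h x| ≤ C) :
    IsHerm (mulOp E h hm C hC) := by
  refine ⟨C ^ 2, by positivity, fun t f => ?_⟩
  have h1 : ‖f + (Complex.I * t) • mulOp E h hm C hC f‖ ≤ ‖((1 + C ^ 2 * t ^ 2 : ℝ) : ℂ) • f‖ := by
    refine norm_le_of_ae ?_
    filter_upwards [coe_add f ((Complex.I * t) • mulOp E h hm C hC f),
      coe_smul (Complex.I * t) (mulOp E h hm C hC f), coe_mulOp hm hC f,
      coe_smul ((1 + C ^ 2 * t ^ 2 : ℝ) : ℂ) f] with x h1 h2 h3 h4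
    have h5 : toL0 f x + Complex.I * t * (h x * toL0 f x) =
        (1 + ((t * h x : ℝ) : ℂ) * Complex.I) * toL0 f x := by
      push_cast
      ring
    rw [h1, h2, h3, h4, h5, norm_mul, norm_mul, Complex.norm_real,
      Real.norm_of_nonneg (by positivity)]
    refine mul_le_mul_of_nonneg_right ?_ (norm_nonneg _)
    have h6 : ‖1 + ((t * h x : ℝ) : ℂ) * Complex.I‖ = √(1 ^ 2 + (t * h x) ^ 2) := by
      have := Complex.norm_add_mul_I 1 (t * h x)
      rwa [Complex.ofReal_one] at this
    have h7 : h x ^ 2 ≤ C ^ 2 := by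
      rw [← sq_abs]
      exact pow_le_pow_left₀ (abs_nonneg _) (hC x) 2
    have h8 : t ^ 2 * h x ^ 2 ≤ t ^ 2 * C ^ 2 := by gcongr
    rw [h6]
    refine Real.sqrt_le_iff.2 ⟨by positivity, ?_⟩
    nlinarith [mul_nonneg (sq_nonneg t) (sq_nonneg C)]
  rwa [norm_smul, Complex.norm_real, Real.norm_of_nonneg (by positivity)] at h1

/-- On `A` the bounded function is a uniform limit of simple functions killed by `K`, and a uniform
error `ε` costs at most `ε‖χ_A‖`. -/
theorem map_proj_eq_zero {K : E →L[ℂ] E}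
    (hK : ∀ (A : Set α) (hA : MeasurableSet A) (hAf : μ A ≠ ∞), K (E.ind A hA hAf) = 0)
    {A : Set α} (hA : MeasurableSet A) (hAf : μ A ≠ ∞) {M : ℝ} {f : E}
    (hfA : ∀ x ∈ A, ‖toL0 f x‖ ≤ M) : K (E.proj A hA f) = 0 := by
  have happrox : ∀ ε > 0, ∀ t : Finset ℂ, ∀ A : Set α, MeasurableSet A → μ A ≠ ∞ →
      (∀ x ∈ A, ∃ y ∈ t, dist (toL0 f x) y < ε) → ∃ g : E, K g = 0 ∧
        ∀ᵐ x ∂μ, (x ∈ A → ‖toL0 f x - toL0 g x‖ ≤ ε) ∧ (x ∉ A → toL0 g x = 0) := by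
    classical
    intro ε hε t
    induction t using Finset.induction_on with
    | empty =>
      intro A hA hAf h
      refine ⟨0, map_zero K, ?_⟩
      filter_upwards [coe_zero (E := E)] with x h1
      exact ⟨fun hx => by simpa using h x hx, fun _ => h1⟩
    | insert y t _ ih =>
      intro A hA hAf h
      have hD : MeasurableSet (A ∩ {x | dist (toL0 f x) y < ε}) :=
        hA.inter (measurableSet_lt ((measurable_coe f).dist measurable_const) measurable_const)
      have hDf := measure_ne_top_of_subset (μ := μ)
        (Set.inter_subset_left : A ∩ {x | dist (toL0 f x) y < ε} ⊆ A) hAf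
      obtain ⟨g, hg, hgA⟩ := ih (A \ {x | dist (toL0 f x) y < ε})
        (hA.diff (measurableSet_lt ((measurable_coe f).dist measurable_const) measurable_const))
        (measure_ne_top_of_subset Set.sdiff_subset hAf) (fun x hx => by
          obtain ⟨z, hz, hxz⟩ := h x hx.1
          rcases Finset.mem_insert.1 hz with rfl | hz
          · exact absurd hxz hx.2
          · exact ⟨z, hz, hxz⟩)
      refine ⟨y • E.ind _ hD hDf + g, by rw [map_add, map_smul, hK, hg, smul_zero, add_zero], ?_⟩
      filter_upwards [hgA, coe_add (y • E.ind _ hD hDf) g, coe_smul y (E.ind _ hD hDf),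
        coe_ind (E := E) hD hDf] with x h1 h2 h3 h4
      rw [h2, h3, h4]
      by_cases hxA : x ∈ A
      · refine ⟨fun _ => ?_, fun h => absurd hxA h⟩
        by_cases hxy : dist (toL0 f x) y < ε
        · have hxD : x ∈ A ∩ {x | dist (toL0 f x) y < ε} := ⟨hxA, hxy⟩
          rw [Set.indicator_of_mem hxD, h1.2 fun h => h.2 hxy, mul_one, add_zero, ← dist_eq_norm]
          exact hxy.le
        · rw [Set.indicator_of_notMem fun h => hxy h.2, mul_zero, zero_add]
          exact h1.1 ⟨hxA, hxy⟩
      · refine ⟨fun h => absurd h hxA, fun _ => ?_⟩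
        rw [Set.indicator_of_notMem fun h => hxA h.1, mul_zero, zero_add]
        exact h1.2 fun h => hxA h.1
  have hsmall : ∀ ε > 0, ‖K (E.proj A hA f)‖ ≤ ‖K‖ * (ε * ‖E.ind A hA hAf‖) := by
    intro ε hε
    obtain ⟨t, ht, hcov⟩ := Metric.totallyBounded_iff.1
      (isCompact_closedBall (0 : ℂ) M).totallyBounded ε hε
    obtain ⟨g, hg, hgA⟩ := happrox ε hε ht.toFinset A hA hAf (fun x hx => by
      have := hcov (mem_closedBall_zero_iff.2 (hfA x hx))
      simpa using this)
    have h1 : ‖E.proj A hA f - g‖ ≤ ‖(ε : ℂ) • E.ind A hA hAf‖ := by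
      refine norm_le_of_ae ?_
      filter_upwards [coe_sub (E.proj A hA f) g, hgA, coe_proj hA f, coe_smul (ε : ℂ) (E.ind A hA hAf),
        coe_ind (E := E) hA hAf] with x h1 h2 h3 h4 h5
      rw [h1, h3, h4, h5]
      by_cases hx : x ∈ A
      · rw [Set.indicator_of_mem hx, Set.indicator_of_mem hx, mul_one, Complex.norm_real, Real.norm_of_nonneg hε.le]
        exact h2.1 hx
      · simp [hx, h2.2 hx]
    rw [norm_smul, Complex.norm_real, Real.norm_of_nonneg hε.le] at h1
    have h2 := K.le_opNorm (E.proj A hA f - g)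
    rw [map_sub, hg, sub_zero] at h2
    exact h2.trans (by gcongr)
  have hlim : Filter.Tendsto (fun ε : ℝ => ‖K‖ * (ε * ‖E.ind A hA hAf‖))
      (nhdsWithin 0 (Set.Ioi 0)) (nhds 0) := by
    have : Continuous fun ε : ℝ => ‖K‖ * (ε * ‖E.ind A hA hAf‖) := by fun_prop
    simpa using (this.tendsto 0).mono_left nhdsWithin_le_nhds
  exact norm_le_zero_iff.1 (ge_of_tendsto hlim (Filter.eventually_of_mem self_mem_nhdsWithin hsmall))

/-- A Hermitian operator vanishing on bounded functions supported on sets of finite measure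
vanishes. -/
theorem eq_zero_of_isHerm_of_ind [SigmaFinite μ] {K : E →L[ℂ] E} (hKH : IsHerm K)
    (hK : ∀ (A : Set α) (hA : MeasurableSet A) (hAf : μ A ≠ ∞), K (E.ind A hA hAf) = 0) :
    K = 0 := by
  ext1 f
  by_contra hne
  obtain ⟨A, M, hA, hAf, hA0, hfM, hgM, hg0⟩ : ∃ (A : Set α) (M : ℝ), MeasurableSet A ∧ μ A ≠ ∞ ∧
      μ A ≠ 0 ∧ (∀ x ∈ A, ‖toL0 f x‖ ≤ M) ∧ (∀ x ∈ A, ‖toL0 (K f) x‖ ≤ M) ∧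
      ∀ x ∈ A, toL0 (K f) x ≠ 0 := by
    by_contra! hall
    refine hne (ext_ae ?_)
    have key : ∀ k n : ℕ, μ (spanningSetsIndex μ ⁻¹' {k} ∩ ({x | ‖toL0 f x‖ ≤ n} ∩
        ({x | ‖toL0 (K f) x‖ ≤ n} ∩ {x | toL0 (K f) x ≠ 0}))) = 0 := by
      intro k n
      by_contra h0
      obtain ⟨x, hx, hx0⟩ := hall _ n
        ((measurableSet_preimage_spanningSetsIndex k).inter
          ((measurableSet_le (measurable_coe f).norm measurable_const).inter
            ((measurableSet_le (measurable_coe (K f)).norm measurable_const).inter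
              ((measurable_coe (K f)) (measurableSet_singleton 0)).compl)))
        (measure_ne_top_of_subset Set.inter_subset_left
          (measure_preimage_spanningSetsIndex_ne_top k)) h0
        (fun x hx => hx.2.1) (fun x hx => hx.2.2.1)
      exact hx.2.2.2 hx0
    filter_upwards [ae_all_iff.2 fun k => ae_all_iff.2 fun n =>
      measure_eq_zero_iff_ae_notMem.1 (key k n), coe_zero (E := E)] with x hx h0
    change toL0 (K f) x = toL0 (0 : E) x
    rw [h0]
    by_contra h1
    obtain ⟨n, hn⟩ := exists_nat_ge (max ‖toL0 f x‖ ‖toL0 (K f) x‖)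
    exact hx _ n ⟨rfl, (le_max_left _ _).trans hn, (le_max_right _ _).trans hn, h1⟩
  -- On `A` both `f` and `Kf` are bounded, so `K` kills `Pf` and `p = P(Kf)`. The cross part `J`
  -- then satisfies `J(Qf) = p` and `Jp = 0`: `1 + itJ` translates along the line `Qf + irp`, on
  -- which the norm must be constant although `p ≠ 0`.
  obtain ⟨C, hC, hJ⟩ := isHerm_cross hKH hA hA.compl disjoint_compl_right
  set P := E.proj A hA with hP
  set Q := E.proj Aᶜ hA.compl with hQ
  have hPQ : ∀ f, P (Q f) = 0 := proj_disjoint hA hA.compl disjoint_compl_right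
  have hQP : ∀ f, Q (P f) = 0 := proj_disjoint hA.compl hA disjoint_compl_left
  have hPP : ∀ f, P (P f) = P f := fun f => proj_eq_self hA (by
    filter_upwards [coe_proj hA f] with x h1 hx
    rw [h1, Set.indicator_of_notMem hx])
  have hQQ : ∀ f, Q (Q f) = Q f := fun f => proj_eq_self hA.compl (by
    filter_upwards [coe_proj hA.compl f] with x h1 hx
    rw [h1, Set.indicator_of_notMem hx])
  have hsum : f = P f + Q f := by
    refine ext_ae ?_
    filter_upwards [coe_add (P f) (Q f), coe_proj hA f, coe_proj hA.compl f] with x h1 h2 h3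
    rw [h1, h2, h3, Set.indicator_self_add_compl_apply]
  have hKP : ∀ g : E, (∀ x ∈ A, ‖toL0 g x‖ ≤ M) → K (P g) = 0 := fun g hg =>
    map_proj_eq_zero hK hA hAf hg
  set p := P (K f) with hp
  have hKQ : K (Q f) = K f := by
    conv_rhs => rw [hsum, map_add, hKP f hfM, zero_add]
  have hKp : K p = 0 := hKP _ hgM
  set φ : ℝ → ℝ := fun r => ‖Q f + (Complex.I * r) • p‖ with hφ
  have hstep : ∀ r t : ℝ, |t| ≤ 1 → φ (r + t) ≤ (1 + C * t ^ 2) * φ r := by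
    intro r t _
    have h1 := hJ t (Q f + (Complex.I * r) • p)
    have h2 : (P ∘L K ∘L Q + Q ∘L K ∘L P) (Q f + (Complex.I * r) • p) = p := by
      simp only [add_apply, ContinuousLinearMap.comp_apply, map_add, map_smul, hQQ, hPQ, hKQ]
      rw [hp, hQP, hPP, ← hp, hKp]
      simp [hp]
    rw [h2] at h1
    convert h1 using 2
    push_cast
    module
  have hle := le_of_forall_le_one_add_sq_mul (φ := φ) hC one_pos (fun _ => norm_nonneg _) hstep
  have hp0 : 0 < ‖p‖ := by
    refine norm_pos_iff.2 fun h => hA0 (measure_eq_zero_iff_ae_notMem.2 ?_)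
    filter_upwards [coe_proj hA (K f), (toL0_congr h).trans coe_zero] with x h1 h2 hx
    rw [h2, Set.indicator_of_mem hx] at h1
    exact hg0 x hx h1.symm
  have h1 := hle ((2 * ‖Q f‖ + 1) / ‖p‖) 0
  have h2 : ‖(Complex.I * ((2 * ‖Q f‖ + 1) / ‖p‖ : ℝ)) • p‖ = 2 * ‖Q f‖ + 1 := by
    rw [norm_smul, norm_mul, Complex.norm_I, Complex.norm_real, one_mul,
      Real.norm_of_nonneg (by positivity), div_mul_cancel₀ _ hp0.ne']
  have h3 := norm_sub_le (Q f + (Complex.I * ((2 * ‖Q f‖ + 1) / ‖p‖ : ℝ)) • p) (Q f)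
  rw [add_sub_cancel_left, h2] at h3
  simp only [hφ, Complex.ofReal_zero, mul_zero, zero_smul, add_zero] at h1
  linarith

/-! ### Hermitian operators as real multipliers -/

theorem exists_pos_ne_top [SigmaFinite μ] (hμ0 : μ ≠ 0) :
    ∃ A, MeasurableSet A ∧ μ A ≠ 0 ∧ μ A ≠ ∞ := by
  by_contra! h
  refine hμ0 (Measure.measure_univ_eq_zero.1 ?_)
  rw [← iUnion_spanningSets μ]
  refine measure_iUnion_null fun n => ?_
  by_contra h0
  exact (measure_spanningSets_lt_top μ n).ne (h _ (measurableSet_spanningSets μ n) h0)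

theorem mulOp_mem_Herm [SigmaFinite μ] (hμ0 : μ ≠ 0) {h : α → ℝ} (hm : Measurable h) {C : ℝ}
    (hC : ∀ x, |h x| ≤ C) : mulOp E h hm C hC ∈ Herm E := by
  obtain ⟨A, hA, h0, hAf⟩ := exists_pos_ne_top hμ0
  have : Nontrivial E := ⟨⟨E.ind A hA hAf, 0, norm_pos_iff.1 (norm_ind_pos hA h0 hAf)⟩⟩
  exact mem_Herm_of_isHerm (isHerm_mulOp hm hC)

/-- A Hermitian operator preserving supports of characteristic functions is a real multiplier. -/
theorem mem_realMultipliers_of_isHerm [SigmaFinite μ] {H : E →L[ℂ] E} (hH : IsHerm H)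
    (hsupp : ∀ (A : Set α) (hA : MeasurableSet A) (hAf : μ A ≠ ∞),
      ∀ᵐ x ∂μ, x ∉ A → toL0 (H (E.ind A hA hAf)) x = 0) : H ∈ E.realMultipliers := by
  obtain ⟨u, hu, hHu⟩ := exists_ae_eq_indicator hsupp
  have hbound : ∀ᵐ x ∂μ, ‖u x‖ ≤ ‖H‖ := ae_norm_le_of_multiplier hu hHu H.le_opNorm
  obtain ⟨C, hC, hHC⟩ := hH
  have hexp : ∀ t : ℝ, ∀ᵐ x ∂μ, ‖1 + Complex.I * t * u x‖ ≤ 1 + C * t ^ 2 := fun t => by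
    refine ae_norm_le_of_multiplier
      (T := ContinuousLinearMap.id ℂ E + (Complex.I * t) • H) (by fun_prop) ?_ (hHC t)
    intro A hA hAf
    have e : (ContinuousLinearMap.id ℂ E + (Complex.I * t) • H) (E.ind A hA hAf) =
      E.ind A hA hAf + (Complex.I * t) • H (E.ind A hA hAf) := rfl
    rw [e]
    filter_upwards [coe_add (E.ind A hA hAf) ((Complex.I * t) • H (E.ind A hA hAf)),
      coe_smul (Complex.I * t) (H (E.ind A hA hAf)), coe_ind (E := E) hA hAf, hHu A hA hAf]
      with x h1 h2 h3 h4
    rw [h1, h2, h3, h4]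
    by_cases hx : x ∈ A <;> simp [hx]
  -- The real part of `1 + itu` is `1 - t Im u`; dividing the bound by `t = ±1/(n + 1)` and letting
  -- `n` grow gives `Im u = 0`. Only countably many `t` are used, so the exceptional null sets can
  -- be united.
  have him : ∀ᵐ x ∂μ, (u x).im = 0 := by
    filter_upwards [ae_all_iff.2 fun n : ℕ => hexp (1 / ((n : ℝ) + 1)),
      ae_all_iff.2 fun n : ℕ => hexp (-(1 / ((n : ℝ) + 1)))] with x h1 h2
    have hre : ∀ t : ℝ, 1 - t * (u x).im ≤ ‖1 + Complex.I * t * u x‖ := fun t => by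
      refine le_trans (le_of_eq ?_) (Complex.re_le_norm _)
      simp [mul_assoc, sub_eq_add_neg]
    have hlim : Filter.Tendsto (fun n : ℕ => C * (1 / ((n : ℝ) + 1))) Filter.atTop (nhds 0) := by
      simpa using tendsto_one_div_add_atTop_nhds_zero_nat.const_mul C
    have h3 : ∀ n : ℕ, |(u x).im| ≤ C * (1 / ((n : ℝ) + 1)) := fun n => by
      have hn : (0 : ℝ) < 1 / ((n : ℝ) + 1) := by positivity
      have h4 := (hre _).trans (h1 n)
      have h5 := (hre _).trans (h2 n)
      rw [abs_le]
      constructor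
      · refine le_of_mul_le_mul_left ?_ hn
        linarith
      · refine le_of_mul_le_mul_left ?_ hn
        linarith
    exact abs_nonpos_iff.1 (ge_of_tendsto' hlim h3)
  -- `Re u` is truncated at `±‖H‖` because `mulOp` requires a bound at every point; this changes it
  -- only on a null set.
  have hm : Measurable fun x => max (-‖H‖) (min ‖H‖ (u x).re) :=
    measurable_const.max (measurable_const.min (Complex.measurable_re.comp hu))
  have hmC : ∀ x, |max (-‖H‖) (min ‖H‖ (u x).re)| ≤ ‖H‖ := fun x =>
    abs_le.2 ⟨le_max_left _ _, max_le (neg_le_self (norm_nonneg H)) (min_le_left _ _)⟩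
  refine ⟨_, hm, ‖H‖, hmC, sub_eq_zero.1 ?_⟩
  refine eq_zero_of_isHerm_of_ind (IsHerm.sub ⟨C, hC, hHC⟩ (isHerm_mulOp hm hmC)) fun A hA hAf => ?_
  refine ext_ae ?_
  rw [sub_apply]
  filter_upwards [coe_sub (H (E.ind A hA hAf)) (mulOp E _ hm ‖H‖ hmC (E.ind A hA hAf)),
    hHu A hA hAf, coe_mulOp hm hmC (E.ind A hA hAf), coe_ind (E := E) hA hAf,
    coe_zero (E := E), hbound, him] with x h1 h2 h3 h4 h5 h6 h7
  rw [h1, h2, h3, h4, h5]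
  by_cases hx : x ∈ A
  · have h8 := abs_le.1 ((Complex.abs_re_le_norm (u x)).trans h6)
    rw [Set.indicator_of_mem hx, Set.indicator_of_mem hx, mul_one, min_eq_right h8.2,
      max_eq_right h8.1, sub_eq_zero]
    exact Complex.ext (by simp) (by simpa using h7)
  · simp [hx]

theorem herm_eq_realMultipliers [SigmaFinite μ] (hμ : DivisibleMeasure μ) (hμ0 : μ ≠ 0)
    (hE : E.IsSymmetric) (hL2 : ¬ E.NormProportionalToL2) : Herm E = E.realMultipliers := by
  refine Set.Subset.antisymm (fun H hH => ?_) ?_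
  · have hH' := isHerm_of_mem_Herm hH
    refine mem_realMultipliers_of_isHerm hH' fun A hA hAf =>
      ae_eq_zero_of_forall_setIntegral_eq_zero hμ hE ?_ hA hAf
    intro A B hA hB hAf hAB hm h0
    by_contra hne
    obtain ⟨κ, hκ, h⟩ := exists_stepNormEqL2 hμ hE hA h0 hAf fun k hk =>
      hasRotationPair hμ hE hH' hA hB hAf hAB hm h0 hne hk
    exact hL2 (h.normProportionalToL2 hμ h0 hAf hκ)
  · rintro _ ⟨h, hm, C, hC, rfl⟩
    exact mulOp_mem_Herm hμ0 hm hC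

end BanachIdealSpace

end

theorem proposition2 (μ : Measure ℝ)
    (hμ : μ = volume ∨ μ = volume.restrict (Set.Icc (0 : ℝ) 1))
    (E : BanachIdealSpace μ) (hsymm : E.IsSymmetric) (hL2 : ¬ E.NormProportionalToL2) :
    Herm E = E.realMultipliers := by
  have hle : μ ≤ volume := by
    rcases hμ with rfl | rfl
    exacts [le_rfl, Measure.restrict_le_self]
  have hσ : SigmaFinite μ := by
    rcases hμ with rfl | rfl <;> infer_instance
  have hμ0 : μ ≠ 0 := by
    rcases hμ with rfl | rfl
    · exact NeZero.ne _
    · rw [Ne, Measure.restrict_eq_zero]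
      simp
  exact BanachIdealSpace.herm_eq_realMultipliers (.of_le_volume hle) hμ0 hsymm hL2
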